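/- **Setting.** Let $\mathcal W\subseteq[-1,1]^{m\times n}$ be a nonempty convex set of real matrices and $G>0$. In the online matrix prediction (OMP) problem $(\mathcal W,G)$, in each round $t=1,2,\dots$ the algorithm receives a pair $(i_t,j_t)\in[m]\times[n]$ from the adversary, chooses $W_t\in\mathcal W$ (depending on the past rounds and on $(i_t,j_t)$), receives a $G$-Lipschitz convex loss $\ell_t:[-1,1]\to\mathbb R$ and suffers $\ell_t(W_{t,(i_t,j_t)})$. Its regret after $T$ rounds is $$\mathrm{Reg}_{\mathrm{OMP}}(T,\mathcal W)=\sum_{t=1}^T\ell_t(W_{t,(i_t,j_t)})-\inf_{U\in\mathcal W}\sum_{t=1}^T\ell_t(U_{i_t,j_t}).$$ For $W\in\mathcal W$ put $\mathrm{sym}(W)=W$ if all matrices in $\mathcal W$ are symmetric (and $m=n$), and $\mathrm{sym}(W)=\begin{bmatrix}0&W\\W^{\mathsf T}&0\end{bmatrix}$ otherwise. For $\beta,\tau>0$, $\mathcal W$ is $(\beta,\tau)$-decomposable if for every $W\in\mathcal W$ there are positive semidefinite $P,Q$ with $\mathrm{sym}(W)=P-Q$, $\mathrm{Tr}(P+Q)\le\tau$,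 and $P_{i,i}\le\beta$, $Q_{i,i}\le\beta$ for every $i$. **Corollary 5.1 (OMP regret bound).** There are absolute constants $C,c>0$ such that the following holds. 1. For all $m,n$, $G,\beta,\tau>0$ and every nonempty convex $(\beta,\tau)$-decomposable $\mathcal W\subseteq[-1,1]^{m\times n}$ there is an algorithm for $(\mathcal W,G)$ with $\mathrm{Reg}_{\mathrm{OMP}}(T,\mathcal W)\le C\,G\sqrt{\beta\tau T}$ for every $T$ and every adversary. In particular, the bound does not depend on $m$ or $n$. 2. *Online max-cut.* Let $\mathcal W\subseteq[-1,1]^{n\times n}$ be the convex hull of the matrices $C^A$, $A\subseteq[n]$, with $C^A_{i,j}=1$ if exactly one of $i,j$ is in $A$ and $C^A_{i,j}=-1$ otherwise. For every $G>0$ some algorithm has regret at most $C\,G\sqrt{nT}$ for all $T$. If $2\le n\le T$, every deterministic algorithm can be forced to have regret at least $c\,G\sqrt{nT}$. 3. *Online gambling.* Let $\mathcal W\subseteq[-1,1]^{n\times n}$ be the convex hull of the matrices $W^\sigma$, $\sigma$ a permutation of $[n]$, with $W^\sigma_{i,j}=1$ if $i$ appears before $j$ in $\sigma$ and $W^\sigma_{i,j}=-1$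 otherwise. For every $G>0$ some algorithm has regret at most $C\,G\ln n\,\sqrt{nT}$ for all $T$. If $2\le n\le T$, every deterministic algorithm can be forced to have regret at least $c\,G\sqrt{nT}$. 4. *Online collaborative filtering.* Let $m\le n$, $\tau>0$ and let $\mathcal W=\{W\in[-1,1]^{n\times m}:\|W\|_{\mathrm{Tr}}\le\tau\}$, where $\|\cdot\|_{\mathrm{Tr}}$ is the sum of the singular values. For every $G>0$ some algorithm has regret at most $C\,G\sqrt{\tau T\sqrt n}$ for all $T$. If $1\le m$, $\sqrt n\le\tau\le m\sqrt n$ and $T\ge\tau\sqrt n$, every deterministic algorithm can be forced to have regret at least $c\,G\sqrt{\tau T\sqrt n}$. The lower bounds in 2, 3 and 4 hold even against the losses $\ell_t(x)=G|x-y_t|$ with $y_t\in\{-1,1\}$ only. -/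

import Mathlib

open Finset

noncomputable section

/-! ### Online matrix prediction -/

/-- A `G`-Lipschitz convex loss on `[-1, 1]`. Losses are written as functions on `ℝ`; only their
restriction to `[-1, 1]` is constrained, and only that restriction enters the regret. -/
def IsOMPLoss (G : ℝ) (l : ℝ → ℝ) : Prop :=
  ConvexOn ℝ (Set.Icc (-1) 1) l ∧
    ∀ x ∈ Set.Icc (-1 : ℝ) 1, ∀ y ∈ Set.Icc (-1 : ℝ) 1, |l x - l y| ≤ G * |x - y|

/-- A (deterministic) algorithm for the online matrix prediction problem with decision space `𝒲`:
from the completed rounds (index pair and loss function of each) and from the index pair of the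
current round it computes its decision matrix, which lies in `𝒲`. -/
structure OMPAlgorithm {m n : ℕ} (𝒲 : Set (Matrix (Fin m) (Fin n) ℝ)) where
  decide : List ((Fin m × Fin n) × (ℝ → ℝ)) → Fin m × Fin n → Matrix (Fin m) (Fin n) ℝ
  decide_mem : ∀ past p, decide past p ∈ 𝒲

namespace OMPAlgorithm

variable {m n : ℕ} {𝒲 : Set (Matrix (Fin m) (Fin n) ℝ)}

/-- The decision matrix of round `t` (rounds are numbered `0, 1, 2, …`) when the adversary plays
the index pairs `p 0, p 1, …` and the loss functions `l 0, l 1, …`. -/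
def decision (A : OMPAlgorithm 𝒲) (p : ℕ → Fin m × Fin n) (l : ℕ → ℝ → ℝ) (t : ℕ) :
    Matrix (Fin m) (Fin n) ℝ :=
  A.decide ((List.range t).map fun s => (p s, l s)) (p t)

/-- Regret after `T` rounds: the cumulative loss of the algorithm minus that of the best fixed
matrix of `𝒲` in hindsight (as an infimum, since `𝒲` need not be closed). -/
def regret (A : OMPAlgorithm 𝒲) (p : ℕ → Fin m × Fin n) (l : ℕ → ℝ → ℝ) (T : ℕ) : ℝ :=
  ∑ t ∈ range T, l t (A.decision p l t (p t).1 (p t).2) -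
    ⨅ U : 𝒲, ∑ t ∈ range T, l t ((U : Matrix (Fin m) (Fin n) ℝ) (p t).1 (p t).2)

/-- Against every adversary with `G`-Lipschitz convex losses, the regret after `T` rounds is at
most `B T`, for every `T`. -/
def AchievesRegret (A : OMPAlgorithm 𝒲) (G : ℝ) (B : ℕ → ℝ) : Prop :=
  ∀ (p : ℕ → Fin m × Fin n) (l : ℕ → ℝ → ℝ), (∀ t, IsOMPLoss G (l t)) →
    ∀ T : ℕ, A.regret p l T ≤ B T

end OMPAlgorithm

/-- Every algorithm for the decision space `𝒲` can be forced to have regret at least `b` after `T`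
rounds, even with the `G`-Lipschitz convex losses `x ↦ G * |x - y|`, `y ∈ {-1, 1}`. -/
def OMPForcedRegret {m n : ℕ} (𝒲 : Set (Matrix (Fin m) (Fin n) ℝ)) (G : ℝ) (T : ℕ) (b : ℝ) :
    Prop :=
  ∀ A : OMPAlgorithm 𝒲, ∃ (p : ℕ → Fin m × Fin n) (y : ℕ → ℝ), (∀ t, y t = 1 ∨ y t = -1) ∧
    b ≤ A.regret p (fun t x => G * |x - y t|) T

/-! ### Decomposable decision spaces -/

/-- The symmetric matrix `S` is a difference `P - Q` of positive semidefinite matrices with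
`tr (P + Q) ≤ τ` and diagonal entries at most `β`. -/
def HasPSDDecomposition {ι : Type} [Fintype ι] (β τ : ℝ) (S : Matrix ι ι ℝ) : Prop :=
  ∃ P Q : Matrix ι ι ℝ, P.PosSemidef ∧ Q.PosSemidef ∧ S = P - Q ∧ (P + Q).trace ≤ τ ∧
    ∀ i, P i i ≤ β ∧ Q i i ≤ β

/-- An `m × n` matrix with `m = n`, viewed as an `m × m` matrix. -/
def asSquare {m n : ℕ} (h : m = n) (W : Matrix (Fin m) (Fin n) ℝ) : Matrix (Fin m) (Fin m) ℝ :=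
  W.submatrix id (Fin.cast h)

/-- All matrices in `𝒲` are (square and) symmetric. -/
def IsSymmetricSpace {m n : ℕ} (𝒲 : Set (Matrix (Fin m) (Fin n) ℝ)) : Prop :=
  ∃ h : m = n, ∀ W ∈ 𝒲, (asSquare h W).IsSymm

/-- `(β, τ)`-decomposability: `sym W` has a decomposition as above for every `W ∈ 𝒲`, where
`sym W` is `W` itself if `𝒲` consists of symmetric matrices, and the block matrix
`[0, W; Wᵀ, 0]` of order `m + n` otherwise. -/
def IsDecomposable {m n : ℕ} (β τ : ℝ) (𝒲 : Set (Matrix (Fin m) (Fin n) ℝ)) : Prop :=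
  ∀ W ∈ 𝒲,
    (IsSymmetricSpace 𝒲 → ∀ h : m = n, HasPSDDecomposition β τ (asSquare h W)) ∧
    (¬ IsSymmetricSpace 𝒲 → HasPSDDecomposition β τ (Matrix.fromBlocks 0 W W.transpose 0))

/-! ### Three decision spaces -/

/-- The matrix of the cut given by `A`: entry `1` where exactly one of `i, j` is in `A`, and `-1`
elsewhere. -/
def cutMatrix {n : ℕ} (A : Finset (Fin n)) : Matrix (Fin n) (Fin n) ℝ :=
  fun i j => if (i ∈ A ∧ j ∉ A) ∨ (i ∉ A ∧ j ∈ A) then 1 else -1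

/-- Online max-cut: the convex hull of the cut matrices. -/
def maxCutSpace (n : ℕ) : Set (Matrix (Fin n) (Fin n) ℝ) :=
  convexHull ℝ (Set.range cutMatrix)

/-- The matrix of a ranking, `σ i` being the position of `i`: entry `1` where `i` comes before `j`,
and `-1` elsewhere. -/
def rankingMatrix {n : ℕ} (σ : Equiv.Perm (Fin n)) : Matrix (Fin n) (Fin n) ℝ :=
  fun i j => if σ i < σ j then 1 else -1

/-- Online gambling: the convex hull of the ranking matrices. -/
def gamblingSpace (n : ℕ) : Set (Matrix (Fin n) (Fin n) ℝ) :=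
  convexHull ℝ (Set.range rankingMatrix)

/-- The trace norm: the sum of the singular values. -/
def traceNorm {m n : ℕ} (W : Matrix (Fin m) (Fin n) ℝ) : ℝ :=
  (Matrix.toEuclideanLin W).singularValues.sum fun _ σ => σ

/-- Online collaborative filtering: the matrices with entries in `[-1, 1]` and trace norm at
most `τ`. -/
def filteringSpace (n m : ℕ) (τ : ℝ) : Set (Matrix (Fin n) (Fin m) ℝ) :=
  {W | (∀ i j, W i j ∈ Set.Icc (-1 : ℝ) 1) ∧ traceNorm W ≤ τ}

end

/-! Upper bounds: follow-the-regularized-leader on triples `(W, P, Q)`, where `P - Q` carries the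
entries of `W`, with regularizer `τ/β - log det (1 + P/β) - log det (1 + Q/β)`. The trace bound
confines it to `[0, τ/β]`. The diagonal bound makes it strongly midpoint convex in each single entry
of `W`, with modulus of order `1/β²` (`Matrix.PosDef.log_det_midpoint`). A round's loss sees only
one entry, so the generic analysis (`exists_algorithm_of_regularizer`) gives regret of order `G
√((τ/β) β² T) = G √(βτT)`, free of the dimensions. Weights growing like `√t` make one algorithm
serve every `T`; near-minimizers replace minimizers because the decision space need not be closed.

The three examples then need only decompositions. A cut matrix is `-χχᵀ`; a ranking matrix factors
through the binary digits of the positions; a matrix of small trace norm factors through its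
singular value decomposition (`hasPSDDecomposition_fromBlocks` turns factorizations into
decompositions).

Lower bounds: if `k` entries can carry every sign pattern, they are played in turn. The losses are
affine on `[-1, 1]`, so the comparator earns `∑ |S_j|`, with `S_j` the sum of the signs shown at
entry `j`. Instead of random signs, the adversary uses the potential `1 - cos (θ S) / (cos θ) ^ N`,
a martingale under fair signs: in every round one of the two signs keeps the algorithm's correlation
below the potential (`exists_signs`). The potential lies below `|S|` by a margin of order `√(T/k)`
per entry, and so the regret is of order `G √(kT)` (`forcedRegret_of_shattered`). -/

/-- Decisions depend only on the losses of earlier rounds. -/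
theorem OMPAlgorithm.decision_congr {m n : ℕ} {𝒲 : Set (Matrix (Fin m) (Fin n) ℝ)}
    (A : OMPAlgorithm 𝒲) (p : ℕ → Fin m × Fin n) {l l' : ℕ → ℝ → ℝ} {t : ℕ}
    (h : ∀ s < t, l s = l' s) : A.decision p l t = A.decision p l' t := by
  unfold OMPAlgorithm.decision
  congr 1
  refine List.map_congr_left fun s hs => ?_
  rw [h s (List.mem_range.1 hs)]

theorem sum_inv_sqrt_succ_le (T : ℕ) : ∑ t ∈ range T, 1 / √((t : ℝ) + 1) ≤ 2 * √T := by
  induction T with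
  | zero => simp
  | succ T ih =>
    rw [sum_range_succ]
    have h1 : 0 < √((T : ℝ) + 1) := Real.sqrt_pos.2 (by positivity)
    have h2 : √((T : ℝ) + 1) ^ 2 = T + 1 := Real.sq_sqrt (by positivity)
    have h3 : √(T : ℝ) ^ 2 = T := Real.sq_sqrt (by positivity)
    have h4 : 0 ≤ √(T : ℝ) := Real.sqrt_nonneg _
    have h5 : 1 / √((T : ℝ) + 1) ≤ 2 * (√((T : ℝ) + 1) - √T) := by
      rw [div_le_iff₀ h1]
      nlinarith [sq_nonneg (√((T : ℝ) + 1) - √T)]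
    push_cast
    linarith

theorem IsOMPLoss.midpoint_le {G : ℝ} {l : ℝ → ℝ} (h : IsOMPLoss G l) {x y : ℝ}
    (hx : x ∈ Set.Icc (-1 : ℝ) 1) (hy : y ∈ Set.Icc (-1 : ℝ) 1) :
    l ((x + y) / 2) ≤ (l x + l y) / 2 := by
  have := h.1.2 hx hy (by norm_num : (0 : ℝ) ≤ 1 / 2) (by norm_num : (0 : ℝ) ≤ 1 / 2) (by norm_num)
  simp only [smul_eq_mul] at this
  rw [show (x + y) / 2 = 1 / 2 * x + 1 / 2 * y by ring]
  linarith

/-! ### Follow-the-regularized-leader with an abstract regularizer. -/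

section FollowTheRegularizedLeader

variable {m n : ℕ} {α : Type} (W : α → Matrix (Fin m) (Fin n) ℝ) (R : α → ℝ) (κ : ℝ)

/-- The objective of follow-the-regularized-leader after the rounds in `past`. -/
noncomputable def ftrlObjective (past : List ((Fin m × Fin n) × (ℝ → ℝ))) (a : α) : ℝ :=
  (past.map fun r => r.2 (W a r.1.1 r.1.2)).sum + κ * √((past.length : ℝ) + 1) * R a

theorem ftrlObjective_concat (past : List ((Fin m × Fin n) × (ℝ → ℝ)))
    (r : (Fin m × Fin n) × (ℝ → ℝ)) (a : α) :
    ftrlObjective W R κ (past ++ [r]) a = ftrlObjective W R κ past a + r.2 (W a r.1.1 r.1.2) +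
      κ * (√((past.length : ℝ) + 1 + 1) - √((past.length : ℝ) + 1)) * R a := by
  simp [ftrlObjective]
  ring

-- Makes the infimum of the objective meaningful: a Lipschitz loss on `[-1, 1]` stays within `|G|`
-- of its value at `0`.
variable {W R κ} {G : ℝ} in
theorem bddBelow_ftrlObjective (hW : ∀ a i j, W a i j ∈ Set.Icc (-1 : ℝ) 1) (hR : ∀ a, 0 ≤ R a)
    (hκ : 0 < κ) (past : List ((Fin m × Fin n) × (ℝ → ℝ)))
    (hpast : ∀ r ∈ past, IsOMPLoss G r.2) :
    BddBelow (Set.range (ftrlObjective W R κ past)) := by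
  have h : ∃ B, ∀ a, B ≤ (past.map fun r => r.2 (W a r.1.1 r.1.2)).sum := by
    induction past with
    | nil => exact ⟨0, by simp⟩
    | cons r past ih =>
      obtain ⟨B, hB⟩ := ih fun r hr => hpast r (List.mem_cons_of_mem _ hr)
      refine ⟨r.2 0 - |G| + B, fun a => ?_⟩
      rw [List.map_cons, List.sum_cons]
      have h1 := (hpast r List.mem_cons_self).2 0 (by simp) _ (hW a r.1.1 r.1.2)
      have h2 : G * |0 - W a r.1.1 r.1.2| ≤ |G| * 1 := by
        refine mul_le_mul (le_abs_self G) ?_ (abs_nonneg _) (abs_nonneg _)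
        rw [zero_sub, abs_neg]
        exact abs_le.2 (hW a r.1.1 r.1.2)
      linarith [hB a, (abs_le.1 h1).2]
  obtain ⟨B, hB⟩ := h
  refine ⟨B, ?_⟩
  rintro _ ⟨a, rfl⟩
  have : 0 ≤ κ * √((past.length : ℝ) + 1) * R a := by have := hR a; positivity
  unfold ftrlObjective
  linarith [hB a]

variable [Nonempty α]

open Classical in
/-- A point minimizing the objective up to `δ`, if there is one. -/
noncomputable def ftrlChoice (δ : ℝ) (past : List ((Fin m × Fin n) × (ℝ → ℝ))) : α :=
  if h : ∃ a, ∀ b, ftrlObjective W R κ past a ≤ ftrlObjective W R κ past b + δ then h.choose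
  else Classical.arbitrary α

theorem ftrlChoice_spec {δ : ℝ} (hδ : 0 < δ) {past : List ((Fin m × Fin n) × (ℝ → ℝ))}
    (h : BddBelow (Set.range (ftrlObjective W R κ past))) (b : α) :
    ftrlObjective W R κ past (ftrlChoice W R κ δ past) ≤ ftrlObjective W R κ past b + δ := by
  have hex : ∃ a, ∀ b, ftrlObjective W R κ past a ≤ ftrlObjective W R κ past b + δ := by
    obtain ⟨a, ha⟩ := exists_lt_of_ciInf_lt
      (show ⨅ a, ftrlObjective W R κ past a < (⨅ a, ftrlObjective W R κ past a) + δ by linarith)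
    exact ⟨a, fun b => by linarith [ciInf_le h b]⟩
  rw [ftrlChoice, dif_pos hex]
  exact hex.choose_spec b

variable {W R κ} {D σ G : ℝ}

/-- One round of follow-the-regularized-leader: the infimum of the objective grows by the loss of
the algorithm, up to a stability term. -/
theorem ftrl_step (hW : ∀ a i j, W a i j ∈ Set.Icc (-1 : ℝ) 1) (hR : ∀ a, 0 ≤ R a)
    (hκ : 0 < κ) (hσ : 0 < σ) (hG : 0 < G)
    (hmid : ∀ a b, ∃ c, (∀ i j, W c i j = (W a i j + W b i j) / 2) ∧
      ∀ i j, R c ≤ (R a + R b) / 2 - σ * (W a i j - W b i j) ^ 2)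
    (past : List ((Fin m × Fin n) × (ℝ → ℝ))) (hpast : ∀ r ∈ past, IsOMPLoss G r.2)
    (r : (Fin m × Fin n) × (ℝ → ℝ)) (hr : IsOMPLoss G r.2) {δ : ℝ}
    (hδ : δ = G ^ 2 / (8 * σ * (κ * √((past.length : ℝ) + 1)))) :
    (⨅ a, ftrlObjective W R κ past a) + r.2 (W (ftrlChoice W R κ δ past) r.1.1 r.1.2) - 2 * δ ≤
      ⨅ a, ftrlObjective W R κ (past ++ [r]) a := by
  have hs : 0 < √((past.length : ℝ) + 1) := Real.sqrt_pos.2 (by positivity)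
  have hδ0 : 0 < δ := by rw [hδ]; positivity
  have hbdd := bddBelow_ftrlObjective hW hR hκ past hpast
  refine le_ciInf fun b => ?_
  obtain ⟨a, ha⟩ : ∃ a, a = ftrlChoice W R κ δ past := ⟨_, rfl⟩
  have hab := ciInf_le hbdd
  have hca := ftrlChoice_spec W R κ hδ0 hbdd
  rw [← ha] at hca ⊢
  have hinf : ftrlObjective W R κ past a ≤ (⨅ a, ftrlObjective W R κ past a) + δ := by
    have := le_ciInf fun b => sub_le_iff_le_add.2 (hca b)
    linarith
  -- The midpoint `c` of the near-minimizer `a` and a competitor `b` cannot beat the infimum, so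
  -- strong convexity forces the objective at `b` above the infimum by `2 λ σ d² - δ`, with `d` the
  -- gap in the played entry.
  obtain ⟨c, hc, hRc⟩ := hmid a b
  set lam := κ * √((past.length : ℝ) + 1) with hlam
  have hlam0 : 0 < lam := by positivity
  have hsum : (past.map fun r => r.2 (W c r.1.1 r.1.2)).sum ≤
      ((past.map fun r => r.2 (W a r.1.1 r.1.2)).sum +
        (past.map fun r => r.2 (W b r.1.1 r.1.2)).sum) / 2 := by
    clear * - hpast hc hW
    induction past with
    | nil => simp
    | cons r past ih =>
      have h1 := ih fun r hr => hpast r (List.mem_cons_of_mem _ hr)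
      simp only [List.map_cons, List.sum_cons]
      have h2 := IsOMPLoss.midpoint_le (hpast r List.mem_cons_self) (hW a r.1.1 r.1.2)
        (hW b r.1.1 r.1.2)
      rw [hc]
      linarith
  set d := W a r.1.1 r.1.2 - W b r.1.1 r.1.2 with hd
  have h1 : ftrlObjective W R κ past c ≤
      (ftrlObjective W R κ past a + ftrlObjective W R κ past b) / 2 - lam * (σ * d ^ 2) := by
    have := mul_le_mul_of_nonneg_left (hRc r.1.1 r.1.2) hlam0.le
    unfold ftrlObjective
    rw [← hlam]
    nlinarith
  have h2 := (abs_le.1 (hr.2 _ (hW a r.1.1 r.1.2) _ (hW b r.1.1 r.1.2))).2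
  rw [← hd] at h2
  -- AM-GM fixes `δ`: it is the cost of trading the loss gap `G |d|` for the quadratic gain. The
  -- same `δ` serves as tolerance of the near-minimizer, hence the total error `2 δ`.
  have h3 : G * |d| ≤ 2 * (lam * (σ * d ^ 2)) + δ := by
    have h4 : δ * (8 * σ * lam) = G ^ 2 := by rw [hδ]; field_simp
    have h5 : 0 ≤ (4 * (σ * lam) * |d| - G) ^ 2 := sq_nonneg _
    have h6 : |d| ^ 2 = d ^ 2 := sq_abs d
    have h7 : 0 < σ * lam := by positivity
    have : G * |d| * (8 * (σ * lam)) ≤ (2 * (lam * (σ * d ^ 2)) + δ) * (8 * (σ * lam)) := by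
      rw [← h6]; nlinarith
    exact le_of_mul_le_mul_right this (by positivity)
  rw [ftrlObjective_concat]
  have h4 : 0 ≤ κ * (√((past.length : ℝ) + 1 + 1) - √((past.length : ℝ) + 1)) * R b := by
    refine mul_nonneg (mul_nonneg hκ.le (sub_nonneg.2 (Real.sqrt_le_sqrt (by linarith)))) (hR b)
  linarith [hab c]

/-- Follow-the-regularized-leader with a bounded regularizer that is strongly midpoint convex
with respect to each entry of the decision matrix. -/
theorem exists_algorithm_of_regularizer {𝒲 : Set (Matrix (Fin m) (Fin n) ℝ)}
    (hmem : ∀ a, W a ∈ 𝒲) (hsurj : ∀ U ∈ 𝒲, ∃ a, W a = U)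
    (hW : ∀ a i j, W a i j ∈ Set.Icc (-1 : ℝ) 1) (hR : ∀ a, 0 ≤ R a) (hRD : ∀ a, R a ≤ D)
    (hD : 0 < D) (hσ : 0 < σ) (hG : 0 < G)
    (hmid : ∀ a b, ∃ c, (∀ i j, W c i j = (W a i j + W b i j) / 2) ∧
      ∀ i j, R c ≤ (R a + R b) / 2 - σ * (W a i j - W b i j) ^ 2) :
    ∃ A : OMPAlgorithm 𝒲, A.AchievesRegret G fun T => 2 * G * √(D / σ * T) := by
  -- This `κ` balances the summed stability errors against the final regularization term; each is at
  -- most `G √(D/σ) √T`.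
  obtain ⟨κ, hκdef⟩ : ∃ κ, κ = G / (2 * √(σ * D)) := ⟨_, rfl⟩
  have hσD : 0 < √(σ * D) := Real.sqrt_pos.2 (by positivity)
  have hκ : 0 < κ := by rw [hκdef]; positivity
  let δ : ℕ → ℝ := fun t => G ^ 2 / (8 * σ * (κ * √((t : ℝ) + 1)))
  refine ⟨⟨fun past _ => W (ftrlChoice W R κ (δ past.length) past), fun _ _ => hmem _⟩, ?_⟩
  intro p l hl T
  set A : OMPAlgorithm 𝒲 :=
    ⟨fun past _ => W (ftrlChoice W R κ (δ past.length) past), fun _ _ => hmem _⟩ with hA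
  -- The estimate `√(T + 1) ≤ 2 √T` used below fails at `T = 0`.
  rcases Nat.eq_zero_or_pos T with rfl | hT
  · have : Nonempty 𝒲 := ⟨⟨_, hmem (Classical.arbitrary α)⟩⟩
    simp [OMPAlgorithm.regret]
  let past : ℕ → List ((Fin m × Fin n) × (ℝ → ℝ)) :=
    fun t => (List.range t).map fun s => (p s, l s)
  have hlen : ∀ t, (past t).length = t := fun t => by simp [past]
  have hpast : ∀ t, ∀ r ∈ past t, IsOMPLoss G r.2 := by
    intro t r hr
    obtain ⟨s, -, rfl⟩ := List.mem_map.1 hr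
    exact hl s
  have hsucc : ∀ t, past (t + 1) = past t ++ [(p t, l t)] := fun t => by
    simp [past, List.range_succ]
  have hinfbound : ∀ t, ∑ s ∈ range t, (l s (A.decision p l s (p s).1 (p s).2) - 2 * δ s) ≤
      ⨅ a, ftrlObjective W R κ (past t) a := by
    intro t
    induction t with
    | zero =>
      rw [range_zero, sum_empty]
      refine le_ciInf fun a => ?_
      have := hR a
      simp only [past, ftrlObjective, List.range_zero, List.map_nil, List.sum_nil, List.length_nil]
      positivity
    | succ t ih =>
      rw [sum_range_succ, hsucc]
      have h1 := ftrl_step hW hR hκ hσ hG hmid (past t) (hpast t) (p t, l t) (hl t)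
        (δ := δ t) (by simp only [δ, hlen])
      have h2 : A.decision p l t = W (ftrlChoice W R κ (δ t) (past t)) := by
        change W (ftrlChoice W R κ (δ (past t).length) (past t)) = _
        rw [hlen]
      rw [h2]
      linarith
  have hδsum : ∑ t ∈ range T, 2 * δ t ≤ G * √(D / σ) * √T := by
    have h1 : ∀ t ∈ range T, 2 * δ t = G * √(D / σ) / 2 * (1 / √((t : ℝ) + 1)) := by
      intro t _
      have h3 : 0 < √((t : ℝ) + 1) := Real.sqrt_pos.2 (by positivity)
      have h4 : √(D / σ) = √(σ * D) / σ := by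
        rw [show D / σ = σ * D / σ ^ 2 by field_simp, Real.sqrt_div (by positivity),
          Real.sqrt_sq hσ.le]
      simp only [δ, hκdef, h4]
      field_simp
      norm_num
    rw [sum_congr rfl h1, ← mul_sum]
    have := mul_le_mul_of_nonneg_left (sum_inv_sqrt_succ_le T)
      (show 0 ≤ G * √(D / σ) / 2 by positivity)
    linarith
  have hcomp : ∀ U : 𝒲, ∑ t ∈ range T, l t (A.decision p l t (p t).1 (p t).2) -
      2 * G * √(D / σ * T) ≤
        ∑ t ∈ range T, l t ((U : Matrix (Fin m) (Fin n) ℝ) (p t).1 (p t).2) := by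
    rintro ⟨U, hU⟩
    obtain ⟨a, rfl⟩ := hsurj U hU
    have h1 := ciInf_le (bddBelow_ftrlObjective hW hR hκ _ (hpast T)) a
    have h2 := hinfbound T
    rw [sum_sub_distrib] at h2
    have h3 : ((past T).map fun r => r.2 (W a r.1.1 r.1.2)).sum =
        ∑ t ∈ range T, l t (W a (p t).1 (p t).2) := by
      simp only [past, List.map_map]
      rw [← List.sum_toFinset _ List.nodup_range, List.toFinset_range]
      rfl
    simp only [ftrlObjective, h3, hlen] at h1
    have h4 : κ * √((T : ℝ) + 1) * R a ≤ G * √(D / σ) * √T := by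
      have h5 : √((T : ℝ) + 1) ≤ 2 * √T := by
        have : (1 : ℝ) ≤ T := by exact_mod_cast hT
        rw [show (2 : ℝ) = √4 by rw [show (4 : ℝ) = 2 ^ 2 by norm_num]; simp,
          ← Real.sqrt_mul (by norm_num)]
        exact Real.sqrt_le_sqrt (by linarith)
      have h6 : κ * D = G * √(D / σ) / 2 := by
        have h8 : √(D / σ) = D / √(σ * D) := by
          rw [show D / σ = D ^ 2 / (σ * D) by field_simp, Real.sqrt_div (by positivity),
            Real.sqrt_sq hD.le]
        rw [hκdef, h8]
        field_simp
      calc κ * √((T : ℝ) + 1) * R a ≤ κ * (2 * √T) * D := by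
            refine mul_le_mul (mul_le_mul_of_nonneg_left h5 hκ.le) (hRD a) (hR a) (by positivity)
        _ = 2 * (κ * D) * √T := by ring
        _ = _ := by rw [h6]; ring
    rw [Real.sqrt_mul (by positivity)]
    linarith
  have : Nonempty 𝒲 := ⟨⟨_, hmem (Classical.arbitrary α)⟩⟩
  have := le_ciInf hcomp
  unfold OMPAlgorithm.regret
  linarith

end FollowTheRegularizedLeader

section

open Matrix
open scoped MatrixOrder Matrix.Norms.L2Operator

/-! ### Strong concavity of the log-determinant. -/

section LogDet

variable {ι : Type} [Fintype ι] [DecidableEq ι]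

/-- A positive definite and a symmetric matrix are simultaneously diagonalized by a congruence. -/
theorem Matrix.PosDef.exists_simultaneous_diagonal {Z H : Matrix ι ι ℝ} (hZ : Z.PosDef)
    (hH : H.IsHermitian) :
    ∃ (K : Matrix ι ι ℝ) (d : ι → ℝ), IsUnit K ∧ Z = star K * K ∧ H = star K * diagonal d * K := by
  obtain ⟨K, rfl⟩ := CStarAlgebra.nonneg_iff_eq_star_mul_self.1 hZ.posSemidef.nonneg
  have hdet : IsUnit K.det := by
    have := (Matrix.isUnit_iff_isUnit_det _).1 hZ.isUnit
    rw [det_mul] at this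
    exact isUnit_of_mul_isUnit_right this
  have hS : (star K⁻¹ * H * K⁻¹).IsHermitian := by
    rw [star_eq_conjTranspose]
    exact isHermitian_conjTranspose_mul_mul _ hH
  have hKK : K⁻¹ * K = 1 := nonsing_inv_mul K hdet
  have hKK' : star K * star K⁻¹ = 1 := by rw [← star_mul, hKK, star_one]
  obtain ⟨U, hU⟩ : ∃ U, U = hS.eigenvectorUnitary := ⟨_, rfl⟩
  have hUU : (U : Matrix ι ι ℝ) * star (U : Matrix ι ι ℝ) = 1 := Unitary.coe_mul_star_self U
  obtain ⟨d, hspec⟩ : ∃ d : ι → ℝ, star K⁻¹ * H * K⁻¹ =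
      (U : Matrix ι ι ℝ) * diagonal d * star (U : Matrix ι ι ℝ) := by
    have := hS.spectral_theorem
    rw [Unitary.conjStarAlgAut_apply, ← hU] at this
    exact ⟨_, this⟩
  refine ⟨star (U : Matrix ι ι ℝ) * K, d, ?_, ?_, ?_⟩
  · exact (IsUnit.of_mul_eq_one _ (by rw [Unitary.coe_star_mul_self])).mul
      ((Matrix.isUnit_iff_isUnit_det _).2 hdet)
  · rw [star_mul, star_star, Matrix.mul_assoc, ← Matrix.mul_assoc _ _ K, hUU, Matrix.one_mul]
  · calc H = star K * star K⁻¹ * H * (K⁻¹ * K) := by rw [hKK, hKK', Matrix.one_mul, Matrix.mul_one]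
      _ = star K * (star K⁻¹ * H * K⁻¹) * K := by simp only [Matrix.mul_assoc]
      _ = _ := by rw [hspec, star_mul, star_star]; simp only [Matrix.mul_assoc]

/-- `log x ≤ x - 1` on the eigenvalues. This is how the trace bound controls the range of the
regularizer. -/
theorem Matrix.PosDef.log_det_le {A : Matrix ι ι ℝ} (hA : A.PosDef) :
    Real.log A.det ≤ A.trace - Fintype.card ι := by
  have h1 := hA.1.det_eq_prod_eigenvalues
  have h2 := hA.1.trace_eq_sum_eigenvalues
  simp only [RCLike.ofReal_real_eq_id, id] at h1 h2
  rw [h1, h2, Real.log_prod fun i _ => (hA.eigenvalues_pos i).ne']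
  calc ∑ i, Real.log (hA.1.eigenvalues i) ≤ ∑ i, (hA.1.eigenvalues i - 1) :=
        sum_le_sum fun i _ => Real.log_le_sub_one_of_pos (hA.eigenvalues_pos i)
    _ = _ := by simp [sum_sub_distrib]

/-- Strong midpoint concavity of `log det` with respect to every matrix entry. -/
theorem Matrix.PosDef.log_det_midpoint {A B : Matrix ι ι ℝ} (hA : A.PosDef) (hB : B.PosDef)
    {b : ℝ} (hAb : ∀ i, A i i ≤ b) (hBb : ∀ i, B i i ≤ b) (i j : ι) :
    (Real.log A.det + Real.log B.det) / 2 + (A i j - B i j) ^ 2 / (8 * b ^ 2) ≤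
      Real.log ((2⁻¹ : ℝ) • (A + B)).det := by
  have hZ : ((2⁻¹ : ℝ) • (A + B)).PosDef := (hA.add hB).smul (by norm_num)
  have hH : ((2⁻¹ : ℝ) • (A - B)).IsHermitian := by
    have := hA.1.sub hB.1
    rw [IsHermitian, conjTranspose_smul, this.eq, star_trivial]
  -- In these coordinates the midpoint is `K*K`, while `A` and `B` become `1 + d` and `1 - d`; the
  -- concavity gap is `-½ ∑ log (1 - d²) ≥ ½ ∑ d²`.
  obtain ⟨K, d, hK, hZK, hHK⟩ := hZ.exists_simultaneous_diagonal hH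
  have hA' : A = star K * diagonal (fun k => 1 + d k) * K := by
    have : diagonal (fun k => 1 + d k) = 1 + diagonal d := by
      rw [← diagonal_one, diagonal_add]
    rw [this, Matrix.mul_add, Matrix.add_mul, Matrix.mul_one, ← hZK, ← hHK, ← smul_add,
      add_add_sub_cancel, ← two_smul ℝ A, smul_smul]
    norm_num
  have hB' : B = star K * diagonal (fun k => 1 - d k) * K := by
    have : diagonal (fun k => 1 - d k) = 1 - diagonal d := by
      rw [← diagonal_one, diagonal_sub]
    rw [this, Matrix.mul_sub, Matrix.sub_mul, Matrix.mul_one, ← hZK, ← hHK, ← smul_sub,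
      add_sub_sub_cancel, ← two_smul ℝ B, smul_smul]
    norm_num
  have hApos : ∀ k, 0 < 1 + d k := by
    rw [hA', hK.posDef_star_left_conjugate_iff] at hA
    exact posDef_diagonal_iff.1 hA
  have hBpos : ∀ k, 0 < 1 - d k := by
    rw [hB', hK.posDef_star_left_conjugate_iff] at hB
    exact posDef_diagonal_iff.1 hB
  have hKdet : K.det ≠ 0 := ((Matrix.isUnit_iff_isUnit_det _).1 hK).ne_zero
  have hKdet' : (star K).det ≠ 0 := by
    rw [star_eq_conjTranspose, det_conjTranspose]; simpa using hKdet
  have hlogA : Real.log A.det =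
      Real.log ((2⁻¹ : ℝ) • (A + B)).det + ∑ k, Real.log (1 + d k) := by
    rw [hZK, hA', det_mul, det_mul, det_mul, det_diagonal,
      ← Real.log_prod fun k _ => (hApos k).ne', ← Real.log_mul (mul_ne_zero hKdet' hKdet)
        (prod_ne_zero_iff.2 fun k _ => (hApos k).ne')]
    congr 1; ring
  have hlogB : Real.log B.det =
      Real.log ((2⁻¹ : ℝ) • (A + B)).det + ∑ k, Real.log (1 - d k) := by
    rw [hZK, hB', det_mul, det_mul, det_mul, det_diagonal,
      ← Real.log_prod fun k _ => (hBpos k).ne', ← Real.log_mul (mul_ne_zero hKdet' hKdet)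
        (prod_ne_zero_iff.2 fun k _ => (hBpos k).ne')]
    congr 1; ring
  have hlog : ∑ k, Real.log (1 + d k) + ∑ k, Real.log (1 - d k) ≤ - ∑ k, d k ^ 2 := by
    rw [← sum_add_distrib, ← sum_neg_distrib]
    refine sum_le_sum fun k _ => ?_
    rw [← Real.log_mul (hApos k).ne' (hBpos k).ne']
    have := Real.log_le_sub_one_of_pos (mul_pos (hApos k) (hBpos k))
    linarith
  have hbpos : 0 < b := hA.diag_pos.trans_le (hAb i)
  -- Squared column norms of `K` are diagonal entries of the midpoint. Cauchy-Schwarz then bounds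
  -- each entry of `A - B` by `d` and `b`.
  have hdiag : ∀ i, ∑ k, K k i ^ 2 ≤ b := by
    intro i
    have h1 : ((2⁻¹ : ℝ) • (A + B)) i i = ∑ k, K k i ^ 2 := by
      rw [hZK, Matrix.mul_apply]
      exact sum_congr rfl fun k _ => by simp [star_apply, sq]
    rw [← h1]
    simp only [smul_apply, add_apply, smul_eq_mul]
    linarith [hAb i, hBb i]
  have hentry : (A i j - B i j) / 2 = ∑ k, d k * (K k i * K k j) := by
    have h1 : ((2⁻¹ : ℝ) • (A - B)) i j = ∑ k, d k * (K k i * K k j) := by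
      rw [hHK, Matrix.mul_apply]
      exact sum_congr rfl fun k _ => by rw [mul_diagonal]; simp [star_apply]; ring
    rw [← h1]
    simp only [smul_apply, sub_apply, smul_eq_mul]
    ring
  have hsq : ((A i j - B i j) / 2) ^ 2 ≤ (∑ k, d k ^ 2) * b ^ 2 := by
    rw [hentry]
    refine (sum_mul_sq_le_sq_mul_sq _ _ _).trans
      (mul_le_mul_of_nonneg_left ?_ (sum_nonneg fun k _ => sq_nonneg _))
    calc ∑ k, (K k i * K k j) ^ 2 ≤ ∑ k, K k i ^ 2 * b := by
          refine sum_le_sum fun k _ => ?_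
          rw [mul_pow]
          refine mul_le_mul_of_nonneg_left ?_ (sq_nonneg _)
          exact (single_le_sum (f := fun k => K k j ^ 2) (fun k _ => sq_nonneg _)
            (mem_univ k)).trans (hdiag j)
      _ ≤ b ^ 2 := by
          rw [← sum_mul, sq]
          exact mul_le_mul_of_nonneg_right (hdiag i) hbpos.le
  have hfin : (A i j - B i j) ^ 2 / (8 * b ^ 2) ≤ (∑ k, d k ^ 2) / 2 := by
    rw [div_le_iff₀ (by positivity)]
    linarith
  linarith

end LogDet

/-! ### The regret bound for decomposable spaces. -/

section LogDetRegularizer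

theorem Matrix.PosSemidef.one_le_det_one_add {ι : Type} [Fintype ι] [DecidableEq ι]
    {P : Matrix ι ι ℝ} (hP : P.PosSemidef) : 1 ≤ (1 + P).det := by
  obtain ⟨K, d, hK, h1, h2⟩ := PosDef.one.exists_simultaneous_diagonal hP.1
  have hd : ∀ k, 0 ≤ d k := by
    rw [h2, hK.posSemidef_star_left_conjugate_iff] at hP
    exact posSemidef_diagonal_iff.1 hP
  have h3 : 1 + P = star K * diagonal (fun k => 1 + d k) * K := by
    have : diagonal (fun k => 1 + d k) = 1 + diagonal d := by
      rw [← diagonal_one, diagonal_add]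
    rw [this, Matrix.mul_add, Matrix.add_mul, Matrix.mul_one, ← h1, ← h2]
  have h4 : (star K).det * K.det = 1 := by rw [← det_mul, ← h1, det_one]
  rw [h3, det_mul, det_mul, det_diagonal, mul_right_comm, h4, one_mul]
  calc (1 : ℝ) = ∏ _k : ι, 1 := by rw [prod_const_one]
    _ ≤ _ := prod_le_prod (fun _ _ => zero_le_one) fun k _ => by linarith [hd k]

/-- The regret bound for decision spaces whose members are read off from differences of positive
semidefinite matrices with bounded trace and bounded diagonal. -/
theorem exists_algorithm_of_psd {m n : ℕ} {𝒲 : Set (Matrix (Fin m) (Fin n) ℝ)} {G β τ : ℝ}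
    (hG : 0 < G) (hβ : 0 < β) (hτ : 0 < τ) (hconv : Convex ℝ 𝒲) (hne : 𝒲.Nonempty)
    (hbox : ∀ W ∈ 𝒲, ∀ i j, W i j ∈ Set.Icc (-1 : ℝ) 1)
    {ι : Type} [Fintype ι] (row : Fin m → ι) (col : Fin n → ι)
    (hdec : ∀ W ∈ 𝒲, ∃ S : Matrix ι ι ℝ, (∀ i j, W i j = S (row i) (col j)) ∧
      HasPSDDecomposition β τ S) :
    ∃ A : OMPAlgorithm 𝒲, A.AchievesRegret G fun T => 16 * (G * √(β * τ * T)) := by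
  classical
  -- Carrying the decomposition along with the matrix keeps the feasible set convex and avoids
  -- choosing `P, Q` as functions of `W`.
  let α : Type := {x : Matrix (Fin m) (Fin n) ℝ × Matrix ι ι ℝ × Matrix ι ι ℝ //
    x.1 ∈ 𝒲 ∧ x.2.1.PosSemidef ∧ x.2.2.PosSemidef ∧
      (∀ i j, x.1 i j = x.2.1 (row i) (col j) - x.2.2 (row i) (col j)) ∧
      (x.2.1 + x.2.2).trace ≤ τ ∧ ∀ i, x.2.1 i i ≤ β ∧ x.2.2 i i ≤ β}
  have hsurj : ∀ U ∈ 𝒲, ∃ a : α, a.1.1 = U := by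
    intro U hU
    obtain ⟨S, hS, P, Q, hP, hQ, rfl, htr, hd⟩ := hdec U hU
    exact ⟨⟨(U, P, Q), hU, hP, hQ, hS, htr, hd⟩, rfl⟩
  have : Nonempty α := by
    obtain ⟨U, hU⟩ := hne
    exact ⟨(hsurj U hU).choose⟩
  let ld : Matrix ι ι ℝ → ℝ := fun P => Real.log (1 + β⁻¹ • P).det
  have hpsd : ∀ P : Matrix ι ι ℝ, P.PosSemidef → (β⁻¹ • P).PosSemidef := fun P hP =>
    hP.smul (inv_nonneg.2 hβ.le)
  have hpd : ∀ P : Matrix ι ι ℝ, P.PosSemidef → (1 + β⁻¹ • P).PosDef := fun P hP =>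
    PosDef.one.add_posSemidef (hpsd P hP)
  have hld0 : ∀ P : Matrix ι ι ℝ, P.PosSemidef → 0 ≤ ld P := fun P hP =>
    Real.log_nonneg (hpsd P hP).one_le_det_one_add
  have hldtr : ∀ P : Matrix ι ι ℝ, P.PosSemidef → ld P ≤ β⁻¹ * P.trace := fun P hP => by
    have := (hpd P hP).log_det_le
    rw [trace_add, trace_one, trace_smul, smul_eq_mul] at this
    change Real.log _ ≤ _
    linarith
  have hldmid : ∀ P P' : Matrix ι ι ℝ, P.PosSemidef → P'.PosSemidef → (∀ i, P i i ≤ β) →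
      (∀ i, P' i i ≤ β) → ∀ i j, (ld P + ld P') / 2 + (P i j - P' i j) ^ 2 / (32 * β ^ 2) ≤
        ld ((2⁻¹ : ℝ) • (P + P')) := by
    intro P P' hP hP' hd hd' i j
    have hdiag : ∀ P : Matrix ι ι ℝ, (∀ i, P i i ≤ β) → ∀ i, (1 + β⁻¹ • P) i i ≤ 2 := by
      intro P hP i
      have : β⁻¹ * P i i ≤ 1 := by
        rw [inv_mul_le_iff₀ hβ, mul_one]; exact hP i
      simp only [Matrix.add_apply, one_apply_eq, Matrix.smul_apply, smul_eq_mul]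
      linarith
    have h1 := (hpd P hP).log_det_midpoint (hpd P' hP') (hdiag P hd) (hdiag P' hd') i j
    have h2 : (2⁻¹ : ℝ) • (1 + β⁻¹ • P + (1 + β⁻¹ • P')) =
        1 + β⁻¹ • ((2⁻¹ : ℝ) • (P + P')) := by
      ext i j
      simp only [Matrix.smul_apply, Matrix.add_apply, smul_eq_mul]
      ring
    have h3 : ((1 + β⁻¹ • P) i j - (1 + β⁻¹ • P') i j) ^ 2 / (8 * 2 ^ 2) =
        (P i j - P' i j) ^ 2 / (32 * β ^ 2) := by
      simp only [Matrix.smul_apply, Matrix.add_apply, smul_eq_mul]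
      field_simp
      ring
    rw [h2, h3] at h1
    exact h1
  -- The diagonals of `1 + P/β` and `1 + Q/β` are at most `2`, giving modulus `1/(32 β²)` for `P`
  -- and `Q` separately; `(x - y)² ≤ 2x² + 2y²` costs another factor `2`. Then `D/σ = 64 βτ`, whence
  -- the constant `2 · 8 = 16`.
  obtain ⟨A, hA⟩ := exists_algorithm_of_regularizer (α := α) (𝒲 := 𝒲) (G := G)
    (W := fun a => a.1.1) (R := fun a => τ / β - ld a.1.2.1 - ld a.1.2.2) (D := τ / β)
    (σ := 1 / (64 * β ^ 2)) (fun a => a.2.1) hsurj (fun a => hbox _ a.2.1)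
    (by
      rintro ⟨⟨U, P, Q⟩, hU, hP, hQ, hS, htr, hd⟩
      have h1 := hldtr P hP
      have h2 := hldtr Q hQ
      have h3 := mul_le_mul_of_nonneg_left htr (inv_nonneg.2 hβ.le)
      simp only [trace_add] at h3 ⊢
      rw [div_eq_inv_mul]
      linarith)
    (by
      rintro ⟨⟨U, P, Q⟩, hU, hP, hQ, hS, htr, hd⟩
      have h1 := hld0 P hP
      have h2 := hld0 Q hQ
      simp only
      linarith)
    (by positivity) (by positivity) hG
    (by
      rintro ⟨⟨U, P, Q⟩, hU, hP, hQ, hS, htr, hd⟩ ⟨⟨U', P', Q'⟩, hU', hP', hQ', hS', htr', hd'⟩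
      simp only at hU hP hQ hS htr hd hU' hP' hQ' hS' htr' hd'
      refine ⟨⟨((2⁻¹ : ℝ) • (U + U'), (2⁻¹ : ℝ) • (P + P'), (2⁻¹ : ℝ) • (Q + Q')), ?_,
        (hP.add hP').smul (by norm_num), (hQ.add hQ').smul (by norm_num), ?_, ?_, ?_⟩, ?_, ?_⟩
      · rw [smul_add]
        exact hconv hU hU' (by norm_num) (by norm_num) (by norm_num)
      · intro i j
        simp only [Matrix.smul_apply, Matrix.add_apply, smul_eq_mul, hS i j, hS' i j]
        ring
      · simp only [trace_add, trace_smul, smul_eq_mul] at htr htr' ⊢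
        linarith
      · intro i
        have h1 := hd i
        have h2 := hd' i
        simp only [Matrix.smul_apply, Matrix.add_apply, smul_eq_mul]
        constructor <;> linarith
      · intro i j
        simp only [Matrix.smul_apply, Matrix.add_apply, smul_eq_mul]
        ring
      · intro i j
        have h1 := hldmid P P' hP hP' (fun i => (hd i).1) (fun i => (hd' i).1) (row i) (col j)
        have h2 := hldmid Q Q' hQ hQ' (fun i => (hd i).2) (fun i => (hd' i).2) (row i) (col j)
        obtain ⟨x, hx⟩ : ∃ x, x = P (row i) (col j) - P' (row i) (col j) := ⟨_, rfl⟩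
        obtain ⟨y, hy⟩ : ∃ y, y = Q (row i) (col j) - Q' (row i) (col j) := ⟨_, rfl⟩
        have h3 : U i j - U' i j = x - y := by rw [hS, hS', hx, hy]; ring
        rw [← hx] at h1
        rw [← hy] at h2
        simp only
        rw [h3]
        have h4 : 1 / (64 * β ^ 2) * (x - y) ^ 2 ≤ x ^ 2 / (32 * β ^ 2) + y ^ 2 / (32 * β ^ 2) := by
          rw [← add_div, one_div_mul_eq_div, div_le_div_iff₀ (by positivity) (by positivity)]
          have : 0 ≤ 32 * β ^ 2 * (x + y) ^ 2 := by positivity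
          nlinarith
        linarith)
  refine ⟨A, fun p l hl T => (hA p l hl T).trans_eq ?_⟩
  have h1 : τ / β / (1 / (64 * β ^ 2)) * (T : ℝ) = 8 ^ 2 * (β * τ * T) := by
    field_simp
    ring
  simp only
  rw [h1, Real.sqrt_mul (by norm_num), Real.sqrt_sq (by norm_num)]
  ring

/-- The regret bound for decomposable decision spaces. -/
theorem IsDecomposable.exists_algorithm {m n : ℕ} {𝒲 : Set (Matrix (Fin m) (Fin n) ℝ)}
    {G β τ : ℝ} (hG : 0 < G) (hβ : 0 < β) (hτ : 0 < τ) (hconv : Convex ℝ 𝒲) (hne : 𝒲.Nonempty)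
    (hbox : ∀ W ∈ 𝒲, ∀ i j, W i j ∈ Set.Icc (-1 : ℝ) 1) (hdec : IsDecomposable β τ 𝒲) :
    ∃ A : OMPAlgorithm 𝒲, A.AchievesRegret G fun T => 16 * (G * √(β * τ * T)) := by
  by_cases h : IsSymmetricSpace 𝒲
  · obtain ⟨rfl, -⟩ := id h
    exact exists_algorithm_of_psd hG hβ hτ hconv hne hbox id id fun W hW =>
      ⟨_, fun i j => rfl, (hdec W hW).1 h rfl⟩
  · exact exists_algorithm_of_psd hG hβ hτ hconv hne hbox Sum.inl Sum.inr fun W hW =>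
      ⟨_, fun i j => rfl, (hdec W hW).2 h⟩

end LogDetRegularizer

end

/-! ### The adaptive adversary and shattered entries. -/

section LowerBound

/-- The potential of the adversary is dominated by `|x|`, with a gain. -/
theorem cos_potential_le {θ c : ℝ} (hθ : 0 < θ) (hc : 0 < c) (k : ℕ) (x : ℝ) :
    c ^ k / θ * (1 - Real.cos (θ * x) / c ^ k) ≤ |x| - (1 - c ^ k) / θ := by
  have h3 : 1 - Real.cos (θ * x) ≤ θ * |x| := by
    rw [← abs_of_pos hθ, ← abs_mul, abs_of_pos hθ]
    rcases le_or_gt 2 |θ * x| with h | h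
    · linarith [Real.neg_one_le_cos (θ * x)]
    · have := Real.one_sub_sq_div_two_le_cos (x := θ * x)
      have h4 := sq_abs (θ * x)
      nlinarith [abs_nonneg (θ * x)]
  have hk : 0 < c ^ k := pow_pos hc k
  have h1 : c ^ k / θ * (1 - Real.cos (θ * x) / c ^ k) = (c ^ k - Real.cos (θ * x)) / θ := by
    field_simp
  rw [h1, le_sub_iff_add_le, ← add_div, div_le_iff₀ hθ]
  linarith

/-- The losses `G * |x - y|` with a sign `y` are affine on `[-1, 1]`. -/
theorem abs_sub_sign {x y : ℝ} (hx : x ∈ Set.Icc (-1 : ℝ) 1) (hy : y = 1 ∨ y = -1) :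
    |x - y| = 1 - x * y := by
  rcases hy with rfl | rfl
  · rw [abs_of_nonpos (by linarith [hx.2])]; ring
  · rw [abs_of_nonneg (by linarith [hx.1])]; ring

variable {m n : ℕ} {𝒲 : Set (Matrix (Fin m) (Fin n) ℝ)} {J : Type} [Fintype J] [DecidableEq J]

/-- The signed count of the block `j` in the first `t` rounds. -/
def blockSum (q : ℕ → J) (y : ℕ → ℝ) (t : ℕ) (j : J) : ℝ :=
  ∑ s ∈ range t with q s = j, y s

/-- The adaptive adversary: there are signs against which the algorithm's correlation with the
signs is dominated by the growth of the potential. -/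
theorem exists_signs (A : OMPAlgorithm 𝒲) (p : ℕ → Fin m × Fin n) (q : ℕ → J) (G θ : ℝ)
    (w : J → ℝ)
    (hcos : Real.cos θ ≠ 0) (t : ℕ) :
    ∃ y : ℕ → ℝ, (∀ s, y s = 1 ∨ y s = -1) ∧
      ∑ s ∈ range t, y s * A.decision p (fun s x => G * |x - y s|) s (p s).1 (p s).2 ≤
        ∑ j, w j * (1 - Real.cos (θ * blockSum q y t j) /
          Real.cos θ ^ #{s ∈ range t | q s = j}) := by
  induction t with
  | zero => exact ⟨fun _ => 1, fun _ => Or.inl rfl, by simp [blockSum]⟩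
  | succ t ih =>
    obtain ⟨y, hy, hle⟩ := ih
    let Y : ℝ → ℕ → ℝ := fun v => Function.update y t v
    have hYs : ∀ v, ∀ s < t, Y v s = y s := fun v s hs =>
      Function.update_of_ne hs.ne _ _
    have hYt : ∀ v, Y v t = v := fun v => Function.update_self _ _ _
    have hdec : ∀ v, ∀ s ≤ t, A.decision p (fun s x => G * |x - Y v s|) s =
        A.decision p (fun s x => G * |x - y s|) s := fun v s hs =>
      A.decision_congr p fun r hr => by rw [hYs v r (hr.trans_le hs)]
    set x := A.decision p (fun s x => G * |x - y s|) t (p t).1 (p t).2 with hx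
    have hcorr : ∀ v, ∑ s ∈ range (t + 1),
        Y v s * A.decision p (fun s x => G * |x - Y v s|) s (p s).1 (p s).2 =
        ∑ s ∈ range t, y s * A.decision p (fun s x => G * |x - y s|) s (p s).1 (p s).2 +
          v * x := by
      intro v
      rw [sum_range_succ, hYt, hdec v t le_rfl]
      congr 1
      refine sum_congr rfl fun s hs => ?_
      rw [hYs v s (mem_range.1 hs), hdec v s (mem_range.1 hs).le]
    have hblock : ∀ v j, blockSum q (Y v) (t + 1) j =
        blockSum q y t j + if q t = j then v else 0 := by
      intro v j
      unfold blockSum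
      rw [sum_filter, sum_filter, sum_range_succ, hYt]
      congr 1
      exact sum_congr rfl fun s hs => by rw [hYs v s (mem_range.1 hs)]
    have hcard : ∀ j, #{s ∈ range (t + 1) | q s = j} =
        #{s ∈ range t | q s = j} + if q t = j then 1 else 0 := by
      intro j
      rw [card_filter, card_filter, sum_range_succ]
    let Φ : ℝ → ℝ := fun v => ∑ j, w j * (1 - Real.cos (θ * blockSum q (Y v) (t + 1) j) /
          Real.cos θ ^ #{s ∈ range (t + 1) | q s = j})
    -- The martingale property, from `cos (a + θ) + cos (a - θ) = 2 cos a cos θ`. The prediction `x`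
    -- does not depend on the current sign and enters as `±x`, so the inequality survives for at
    -- least one sign.
    have hΦ : Φ 1 + Φ (-1) = 2 * (∑ j, w j * (1 - Real.cos (θ * blockSum q y t j) /
          Real.cos θ ^ #{s ∈ range t | q s = j})) := by
      simp only [Φ]
      rw [← sum_add_distrib, mul_sum _ _ (2 : ℝ)]
      refine sum_congr rfl fun j _ => ?_
      rw [hblock, hblock, hcard]
      split_ifs with h
      · rw [mul_add, mul_add, mul_neg, mul_one, ← sub_eq_add_neg, Real.cos_add, Real.cos_sub,
          pow_succ]
        have := pow_ne_zero #{s ∈ range t | q s = j} hcos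
        field_simp
        ring
      · simp only [add_zero]; ring
    rcases le_total (∑ s ∈ range t, y s *
        A.decision p (fun s x => G * |x - y s|) s (p s).1 (p s).2 + 1 * x) (Φ 1) with h | h
    · refine ⟨Y 1, fun s => ?_, (hcorr 1).trans_le h⟩
      by_cases hs : s = t
      · rw [hs, hYt]; exact Or.inl rfl
      · simp only [Y, Function.update_of_ne hs]; exact hy s
    · refine ⟨Y (-1), fun s => ?_, (hcorr (-1)).trans_le ?_⟩
      · by_cases hs : s = t
        · rw [hs, hYt]; exact Or.inr rfl
        · simp only [Y, Function.update_of_ne hs]; exact hy s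
      · change _ ≤ Φ (-1)
        linarith

theorem div_le_card_filter_mod {k : ℕ} (hk : 0 < k) (T : ℕ) (j : Fin k) :
    T / k ≤ #{s ∈ range T | (⟨s % k, Nat.mod_lt s hk⟩ : Fin k) = j} := by
  rw [← card_range (T / k)]
  refine card_le_card_of_injOn (fun i => i * k + j) ?_ ?_
  · intro i hi
    have hi' : i + 1 ≤ T / k := by simpa using hi
    have h1 : (i + 1) * k ≤ T := (Nat.mul_le_mul_right k hi').trans (Nat.div_mul_le_self T k)
    have h2 := j.2
    simp only [coe_filter, mem_range, Set.mem_ofPred_eq]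
    refine ⟨by rw [add_mul] at h1; omega, Fin.ext ?_⟩
    simp [Nat.mod_eq_of_lt h2]
  · intro i _ i' _ h
    simpa [hk.ne'] using h

/-- From `cos² x ≤ 1/(1 + x²)` and Bernoulli's `(1 + 1/N)^N ≥ 2`, the `N`-th power is at most `1/√2
< 3/4`. This leaves a margin of at least `√N / 4` per entry. -/
theorem cos_inv_sqrt_pow_le {N k : ℕ} (hN : 0 < N) (hk : N ≤ k) :
    0 < Real.cos (1 / √N) ∧ Real.cos (1 / √N) ^ k ≤ 3 / 4 := by
  have hN1 : (1 : ℝ) ≤ N := by exact_mod_cast hN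
  have hθ0 : 0 < 1 / √(N : ℝ) := by positivity
  have hθ1 : 1 / √(N : ℝ) ≤ 1 := by
    rw [div_le_one (by positivity)]
    exact Real.one_le_sqrt.2 hN1
  have hsq : (1 / √(N : ℝ)) ^ 2 = 1 / N := by
    rw [div_pow, Real.sq_sqrt (by positivity), one_pow]
  have hcos : 0 < Real.cos (1 / √N) := Real.cos_pos_of_le_one (by rw [abs_of_pos hθ0]; exact hθ1)
  refine ⟨hcos, ?_⟩
  have h1 := Real.cos_lt_one_div_sqrt_sq_add_one (x := 1 / √N)
    (by linarith [Real.pi_gt_three]) (by linarith [Real.pi_gt_three]) hθ0.ne'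
  have h2 : (Real.cos (1 / √N)) ^ 2 ≤ 1 / (1 / N + 1) := by
    calc (Real.cos (1 / √N)) ^ 2 ≤ (1 / √((1 / √N) ^ 2 + 1)) ^ 2 :=
          pow_le_pow_left₀ hcos.le h1.le 2
      _ = 1 / (1 / N + 1) := by
          rw [div_pow, Real.sq_sqrt (by positivity), one_pow, hsq]
  have h3 : (2 : ℝ) ≤ (1 / N + 1) ^ N := by
    have := one_add_mul_le_pow (a := 1 / (N : ℝ)) (by
      have : (0 : ℝ) < 1 / N := by positivity
      linarith) N
    rw [mul_one_div_cancel (by positivity)] at this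
    rw [add_comm (1 / (N : ℝ))]
    linarith
  have h4 : (Real.cos (1 / √N) ^ N) ^ 2 ≤ 1 / 2 := by
    rw [← pow_mul, mul_comm, pow_mul]
    calc ((Real.cos (1 / √N)) ^ 2) ^ N ≤ (1 / (1 / N + 1)) ^ N :=
          pow_le_pow_left₀ (sq_nonneg _) h2 N
      _ = 1 / (1 / N + 1) ^ N := by rw [div_pow, one_pow]
      _ ≤ 1 / 2 := one_div_le_one_div_of_le (by norm_num) h3
  have h5 : Real.cos (1 / √N) ^ k ≤ Real.cos (1 / √N) ^ N :=
    pow_le_pow_of_le_one hcos.le (Real.cos_le_one _) hk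
  refine h5.trans ?_
  by_contra! h
  nlinarith

/-- If every sign pattern on `k` of the entries is realized in the decision space, then every
algorithm has regret of order `√(k T)`. -/
theorem forcedRegret_of_shattered (hbox : ∀ W ∈ 𝒲, ∀ i j, W i j ∈ Set.Icc (-1 : ℝ) 1) {k T : ℕ}
    (hk : 0 < k) (hkT : k ≤ T) {G : ℝ} (hG : 0 < G) (e : Fin k → Fin m × Fin n)
    (hshatter : ∀ s : Fin k → ℝ, (∀ j, s j = 1 ∨ s j = -1) →
      ∃ U ∈ 𝒲, ∀ j, U (e j).1 (e j).2 = s j) :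
    OMPForcedRegret 𝒲 G T (G * √(k * T) / 6) := by
  intro A
  let q : ℕ → Fin k := fun t => ⟨t % k, Nat.mod_lt t hk⟩
  have hN : 0 < T / k := Nat.div_pos hkT hk
  set θ : ℝ := 1 / √((T / k : ℕ) : ℝ) with hθ
  have hcos : 0 < Real.cos θ := (cos_inv_sqrt_pow_le hN le_rfl).1
  have hθ0 : 0 < θ := by positivity
  -- The weights contain the final visit counts; these are known beforehand because the order of the
  -- entries is fixed.
  obtain ⟨y, hy, hle⟩ := exists_signs A (fun t => e (q t)) q G θ
    (fun j => Real.cos θ ^ #{s ∈ range T | q s = j} / θ) hcos.ne' T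
  refine ⟨fun t => e (q t), y, hy, ?_⟩
  have hgain : ∑ j : Fin k, Real.cos θ ^ #{s ∈ range T | q s = j} / θ *
      (1 - Real.cos (θ * blockSum q y T j) / Real.cos θ ^ #{s ∈ range T | q s = j}) ≤
      ∑ j, |blockSum q y T j| - √(k * T) / 6 := by
    have h1 : ∀ j ∈ (univ : Finset (Fin k)), Real.cos θ ^ #{s ∈ range T | q s = j} / θ *
        (1 - Real.cos (θ * blockSum q y T j) / Real.cos θ ^ #{s ∈ range T | q s = j}) ≤
        |blockSum q y T j| - √((T / k : ℕ) : ℝ) / 4 := by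
      intro j _
      refine (cos_potential_le hθ0 hcos _ _).trans (sub_le_sub_left ?_ _)
      have := (cos_inv_sqrt_pow_le hN (div_le_card_filter_mod hk T j)).2
      rw [hθ, div_div_eq_mul_div, div_one, mul_comm, div_eq_mul_one_div]
      refine mul_le_mul_of_nonneg_left ?_ (Real.sqrt_nonneg _)
      linarith
    refine (sum_le_sum h1).trans ?_
    rw [sum_sub_distrib, sum_const, card_univ, Fintype.card_fin, nsmul_eq_mul]
    refine sub_le_sub_left ?_ _
    have h2 : (T : ℝ) ≤ 2 * k * (T / k : ℕ) := by
      have h3 := Nat.lt_div_mul_add (a := T) hk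
      have h4 : k ≤ T / k * k := Nat.le_mul_of_pos_left k hN
      have h5 : T ≤ 2 * k * (T / k) := by nlinarith
      exact_mod_cast h5
    -- As `k ≤ T`, rounding `T/k` down loses at most a factor `2`, and `√2 ≤ 3/2`; this turns the
    -- margin `k √(T/k) / 4` into `√(kT) / 6`.
    have h3 : √((k : ℝ) * T) ≤ 3 / 2 * (k * √((T / k : ℕ) : ℝ)) := by
      refine Real.sqrt_le_iff.2 ⟨by positivity, ?_⟩
      rw [mul_pow, mul_pow, Real.sq_sqrt (by positivity)]
      have h6 : (k : ℝ) * T ≤ k * (2 * k * (T / k : ℕ)) :=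
        mul_le_mul_of_nonneg_left h2 (by positivity)
      have h7 : (0 : ℝ) ≤ (k : ℝ) ^ 2 * (T / k : ℕ) := by positivity
      nlinarith
    linarith
  have hsum : ∀ s : Fin k → ℝ, ∑ t ∈ range T, s (q t) * y t = ∑ j, s j * blockSum q y T j := by
    intro s
    rw [← sum_fiberwise (range T) q]
    refine sum_congr rfl fun j _ => ?_
    rw [blockSum, mul_sum]
    refine sum_congr rfl fun t ht => ?_
    rw [(mem_filter.1 ht).2]
  obtain ⟨U, hU, hUs⟩ := hshatter (fun j => if 0 ≤ blockSum q y T j then 1 else -1)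
    fun j => by split_ifs <;> simp
  have hbest : ∑ t ∈ range T, G * |U (e (q t)).1 (e (q t)).2 - y t| =
      G * (T - ∑ j, |blockSum q y T j|) := by
    rw [← mul_sum, sum_congr rfl fun t _ => abs_sub_sign (hbox U hU _ _) (hy t), sum_sub_distrib]
    simp only [hUs]
    rw [hsum fun j => if 0 ≤ blockSum q y T j then 1 else -1]
    simp only [sum_const, card_range, nsmul_eq_mul, mul_one]
    congr 2
    refine sum_congr rfl fun j _ => ?_
    split_ifs with h
    · rw [abs_of_nonneg h, one_mul]
    · rw [abs_of_neg (not_le.1 h), neg_one_mul]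
  have hmem : ∀ t, A.decision (fun t => e (q t)) (fun t x => G * |x - y t|) t ∈ 𝒲 :=
    fun t => A.decide_mem _ _
  have halg : ∑ t ∈ range T, G * |A.decision (fun t => e (q t)) (fun t x => G * |x - y t|) t
      (e (q t)).1 (e (q t)).2 - y t| = G * (T - ∑ t ∈ range T, y t *
        A.decision (fun t => e (q t)) (fun t x => G * |x - y t|) t (e (q t)).1 (e (q t)).2) := by
    rw [← mul_sum, sum_congr rfl fun t _ =>
      abs_sub_sign (hbox _ (hmem t) _ _) (hy t), sum_sub_distrib]
    simp only [sum_const, card_range, nsmul_eq_mul, mul_one, mul_comm (y _)]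
  have hinf : ⨅ U : 𝒲, ∑ t ∈ range T,
      G * |(U : Matrix (Fin m) (Fin n) ℝ) (e (q t)).1 (e (q t)).2 - y t| ≤
        G * (T - ∑ j, |blockSum q y T j|) := by
    rw [← hbest]
    refine ciInf_le (f := fun U : 𝒲 => ∑ t ∈ range T,
      G * |(U : Matrix (Fin m) (Fin n) ℝ) (e (q t)).1 (e (q t)).2 - y t|) ⟨0, ?_⟩ ⟨U, hU⟩
    rintro _ ⟨V, rfl⟩
    exact sum_nonneg fun t _ => by positivity
  have hfin := mul_le_mul_of_nonneg_left (hle.trans hgain) hG.le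
  unfold OMPAlgorithm.regret
  rw [halg]
  linarith

end LowerBound

section

open Matrix
open scoped MatrixOrder Matrix.Norms.L2Operator

/-! ### Building decompositions. -/

section Decompositions

/-- Reduces a convex hull to its generating matrices. -/
theorem convex_hasPSDDecomposition {ι : Type} [Fintype ι] (β τ : ℝ) :
    Convex ℝ {S : Matrix ι ι ℝ | HasPSDDecomposition β τ S} := by
  rintro S ⟨P, Q, hP, hQ, rfl, htr, hd⟩ S' ⟨P', Q', hP', hQ', rfl, htr', hd'⟩ a b ha hb hab
  have hconv : ∀ x y z : ℝ, x ≤ z → y ≤ z → a * x + b * y ≤ z := by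
    intro x y z hx hy
    have h1 := mul_le_mul_of_nonneg_left hx ha
    have h2 := mul_le_mul_of_nonneg_left hy hb
    calc a * x + b * y ≤ (a + b) * z := by linarith
      _ = z := by rw [hab, one_mul]
  refine ⟨a • P + b • P', a • Q + b • Q', (hP.smul ha).add (hP'.smul hb),
    (hQ.smul ha).add (hQ'.smul hb), ?_, ?_, fun i => ⟨?_, ?_⟩⟩
  · rw [smul_sub, smul_sub]; abel
  · have := hconv _ _ _ htr htr'
    simp only [trace_add, trace_smul, smul_eq_mul] at this ⊢
    linarith
  · exact hconv _ _ _ (hd i).1 (hd' i).1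
  · exact hconv _ _ _ (hd i).2 (hd' i).2

/-- A factorization through short vectors gives a decomposition of the symmetrization. -/
theorem hasPSDDecomposition_fromBlocks {m n : ℕ} {κ : Type} [Fintype κ]
    (X : Matrix (Fin m) κ ℝ) (Y : Matrix (Fin n) κ ℝ) {r τ : ℝ}
    (hX : ∀ i, ∑ k, X i k ^ 2 ≤ r) (hY : ∀ j, ∑ k, Y j k ^ 2 ≤ r)
    (htr : ∑ i, ∑ k, X i k ^ 2 + ∑ j, ∑ k, Y j k ^ 2 ≤ τ) :
    HasPSDDecomposition (r / 2) τ (fromBlocks 0 (X * Yᵀ) (X * Yᵀ)ᵀ 0) := by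
  have hfac : ∀ Z : Matrix (Fin n) κ ℝ, fromRows X Z * (fromRows X Z)ᴴ =
      fromBlocks (X * Xᵀ) (X * Zᵀ) (Z * Xᵀ) (Z * Zᵀ) := by
    intro Z
    rw [conjTranspose_eq_transpose_of_trivial, transpose_fromRows, fromRows_mul_fromCols]
  have hnorm : ∀ {l : ℕ} (Z : Matrix (Fin l) κ ℝ) i, (Z * Zᵀ) i i = ∑ k, Z i k ^ 2 := by
    intro l Z i
    rw [mul_apply]
    exact sum_congr rfl fun k _ => by rw [transpose_apply, sq]
  -- Polarization: flipping the sign of `Y` preserves the diagonal blocks of the Gram matrix and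
  -- negates the off-diagonal ones.
  refine ⟨(2⁻¹ : ℝ) • (fromRows X Y * (fromRows X Y)ᴴ),
    (2⁻¹ : ℝ) • (fromRows X (-Y) * (fromRows X (-Y))ᴴ),
    (posSemidef_self_mul_conjTranspose _).smul (by norm_num),
    (posSemidef_self_mul_conjTranspose _).smul (by norm_num), ?_, ?_, ?_⟩
  · rw [hfac, hfac, ← smul_sub]
    ext (i | i) (j | j)
    · simp
    · simp only [fromBlocks_apply₁₂, Matrix.smul_apply, Matrix.sub_apply, transpose_neg,
        Matrix.mul_neg, Matrix.neg_apply, smul_eq_mul]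
      ring
    · simp only [fromBlocks_apply₂₁, Matrix.smul_apply, Matrix.sub_apply, Matrix.neg_mul,
        Matrix.neg_apply, smul_eq_mul, transpose_mul, transpose_transpose]
      ring
    · simp
  · rw [hfac, hfac, trace_add, trace_smul, trace_smul]
    simp only [trace, Fintype.sum_sum_type, diag_apply, fromBlocks_apply₁₁, fromBlocks_apply₂₂,
      hnorm, Matrix.neg_apply, neg_sq, smul_eq_mul]
    linarith
  · rw [hfac, hfac]
    rintro (i | i)
    · simp only [Matrix.smul_apply, fromBlocks_apply₁₁, hnorm, smul_eq_mul]
      constructor <;> linarith [hX i]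
    · simp only [Matrix.smul_apply, fromBlocks_apply₂₂, hnorm, smul_eq_mul, Matrix.neg_apply,
        neg_sq]
      constructor <;> linarith [hY i]

theorem convex_box (m n : ℕ) :
    Convex ℝ {W : Matrix (Fin m) (Fin n) ℝ | ∀ i j, W i j ∈ Set.Icc (-1 : ℝ) 1} := by
  intro W hW W' hW' a b ha hb hab i j
  exact convex_Icc (-1 : ℝ) 1 (hW i j) (hW' i j) ha hb hab

end Decompositions

theorem OMPForcedRegret.mono {m n : ℕ} {𝒲 : Set (Matrix (Fin m) (Fin n) ℝ)} {G b b' : ℝ} {T : ℕ}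
    (h : OMPForcedRegret 𝒲 G T b) (hb : b' ≤ b) : OMPForcedRegret 𝒲 G T b' := fun A => by
  obtain ⟨p, y, hy, hle⟩ := h A
  exact ⟨p, y, hy, hb.trans hle⟩

/-- Absorbs the discrepancy between the number of shattered entries and the nominal dimension, e.g.
`n - 1` against `n`. -/
theorem forcedRegret_const_le {G x y : ℝ} (hG : 0 < G) (h : x ≤ 4 * y) :
    1 / 12 * (G * √x) ≤ G * √y / 6 := by
  have h1 : √x ≤ 2 * √y := by
    rw [show (2 : ℝ) = √4 by rw [show (4 : ℝ) = 2 ^ 2 by norm_num]; simp,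
      ← Real.sqrt_mul (by norm_num)]
    exact Real.sqrt_le_sqrt h
  nlinarith

theorem exists_algorithm_of_isEmpty {m n : ℕ} {𝒲 : Set (Matrix (Fin m) (Fin n) ℝ)}
    (hne : 𝒲.Nonempty) [IsEmpty (Fin m × Fin n)] (G : ℝ) (B : ℕ → ℝ) :
    ∃ A : OMPAlgorithm 𝒲, A.AchievesRegret G B := by
  obtain ⟨U, hU⟩ := hne
  exact ⟨⟨fun _ _ => U, fun _ _ => hU⟩, fun p => isEmptyElim (p 0)⟩

/-! ### Online max-cut. -/

section MaxCut

theorem maxCutSpace_nonempty (n : ℕ) : (maxCutSpace n).Nonempty :=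
  (Set.range_nonempty _).convexHull

theorem maxCutSpace_box {n : ℕ} :
    ∀ W ∈ maxCutSpace n, ∀ i j, W i j ∈ Set.Icc (-1 : ℝ) 1 := by
  refine convexHull_min ?_ (convex_box n n)
  rintro _ ⟨A, rfl⟩ i j
  unfold cutMatrix
  split_ifs <;> norm_num

theorem hasPSDDecomposition_of_mem_maxCutSpace {n : ℕ} :
    ∀ W ∈ maxCutSpace n, HasPSDDecomposition 1 (n : ℝ) W := by
  refine convexHull_min ?_ (convex_hasPSDDecomposition 1 (n : ℝ))
  rintro _ ⟨A, rfl⟩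
  -- The cut matrix is `-χχᵀ`, so `P = 0` and `Q = χχᵀ`, with unit diagonal and trace `n`.
  let χ : Fin n → ℝ := fun i => if i ∈ A then 1 else -1
  have hχ : ∀ i, χ i * χ i = 1 := fun i => by simp only [χ]; split_ifs <;> norm_num
  refine ⟨0, vecMulVec χ (star χ), PosSemidef.zero, posSemidef_vecMulVec_self_star χ, ?_, ?_,
    fun i => ⟨by simp, ?_⟩⟩
  · ext i j
    rw [zero_sub, Matrix.neg_apply, vecMulVec_apply]
    simp only [cutMatrix, χ, star_trivial]
    by_cases hi : i ∈ A <;> by_cases hj : j ∈ A <;> simp [hi, hj]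
  · rw [zero_add, trace]
    simp [vecMulVec_apply, hχ]
  · rw [vecMulVec_apply, star_trivial, hχ]

theorem maxCut_exists_algorithm (n : ℕ) {G : ℝ} (hG : 0 < G) :
    ∃ A : OMPAlgorithm (maxCutSpace n), A.AchievesRegret G fun T => 16 * (G * √(n * T)) := by
  rcases Nat.eq_zero_or_pos n with rfl | hn
  · exact exists_algorithm_of_isEmpty (maxCutSpace_nonempty 0) _ _
  · have h := exists_algorithm_of_psd (𝒲 := maxCutSpace n) (τ := n) hG one_pos (by exact_mod_cast hn)
      (convex_convexHull ℝ _) (maxCutSpace_nonempty n) maxCutSpace_box id id fun W hW =>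
        ⟨W, fun i j => rfl, hasPSDDecomposition_of_mem_maxCutSpace W hW⟩
    simpa only [one_mul] using h

theorem maxCut_forcedRegret {n T : ℕ} {G : ℝ} (hG : 0 < G) (hn : 2 ≤ n) (hT : n ≤ T) :
    OMPForcedRegret (maxCutSpace n) G T (1 / 12 * (G * √(n * T))) := by
  obtain ⟨k, rfl⟩ : ∃ k, n = k + 1 := ⟨n - 1, by omega⟩
  refine (forcedRegret_of_shattered (k := k) (T := T) maxCutSpace_box (by omega) (by omega) hG
    (fun j => (0, j.succ)) fun s hs => ?_).mono (forcedRegret_const_le hG ?_)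
  -- With `0` outside the cut set, row `0` off the diagonal reads off membership, so it is
  -- shattered.
  · refine ⟨cutMatrix ((univ.filter fun j => s j = 1).map (Fin.succEmb k)),
      subset_convexHull ℝ _ ⟨_, rfl⟩, fun j => ?_⟩
    rcases hs j with h | h
    · simp [cutMatrix, h, Fin.succ_ne_zero]
    · have : (-1 : ℝ) ≠ 1 := by norm_num
      simp [cutMatrix, h, Fin.succ_ne_zero, this]
  · have h1 : (1 : ℝ) ≤ k := by exact_mod_cast (by omega : 1 ≤ k)
    have h2 : (0 : ℝ) ≤ T := by positivity
    push_cast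
    nlinarith

end MaxCut

/-! ### Online gambling. -/

section Gambling

theorem gamblingSpace_nonempty (n : ℕ) : (gamblingSpace n).Nonempty :=
  (Set.range_nonempty _).convexHull

theorem gamblingSpace_box {n : ℕ} :
    ∀ W ∈ gamblingSpace n, ∀ i j, W i j ∈ Set.Icc (-1 : ℝ) 1 := by
  refine convexHull_min ?_ (convex_box n n)
  rintro _ ⟨A, rfl⟩ i j
  unfold rankingMatrix
  split_ifs <;> norm_num

theorem gambling_forcedRegret {n T : ℕ} {G : ℝ} (hG : 0 < G) (hn : 2 ≤ n) (hT : n ≤ T) :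
    OMPForcedRegret (gamblingSpace n) G T (1 / 12 * (G * √(n * T))) := by
  obtain ⟨k, rfl⟩ : ∃ k, n = k + 1 := ⟨n - 1, by omega⟩
  refine (forcedRegret_of_shattered (k := k) (T := T) gamblingSpace_box (by omega) (by omega) hG
    (fun j => (0, j.succ)) fun s hs => ?_).mono (forcedRegret_const_le hG ?_)
  -- Sorting by `f` places item `0` (value `0`) after the items of sign `-1` and before those of
  -- sign `1`.
  · let f : Fin (k + 1) → ℝ := Fin.cons 0 s
    have hsort : ∀ a b, f a < f b → (Tuple.sort f).symm a < (Tuple.sort f).symm b := by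
      intro a b hab
      by_contra! h
      have := Tuple.monotone_sort f h
      simp only [Function.comp_apply, Equiv.apply_symm_apply] at this
      exact absurd hab (not_lt.2 this)
    refine ⟨rankingMatrix (Tuple.sort f).symm, subset_convexHull ℝ _ ⟨_, rfl⟩, fun j => ?_⟩
    rcases hs j with h | h
    · have := hsort 0 j.succ (by simp [f, h])
      simp only [rankingMatrix, if_pos this, h]
    · have := hsort j.succ 0 (by simp [f, h])
      simp only [rankingMatrix, if_neg this.not_gt, h]
  · have h1 : (1 : ℝ) ≤ k := by exact_mod_cast (by omega : 1 ≤ k)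
    have h2 : (0 : ℝ) ≤ T := by positivity
    push_cast
    nlinarith

/-- The order on `{0, …, 2 ^ k - 1}`, read off at the highest bit where two numbers differ. -/
theorem sum_bit_lt (k : ℕ) : ∀ a b : ℕ, a < 2 ^ k → b < 2 ^ k →
    ∑ l ∈ range k, (if a / 2 ^ (l + 1) = b / 2 ^ (l + 1) ∧ a / 2 ^ l % 2 = 0 ∧ b / 2 ^ l % 2 = 1
      then (1 : ℝ) else 0) = if a < b then 1 else 0 := by
  induction k with
  | zero => intro a b ha hb; simp at ha hb; simp [ha, hb]
  | succ k ih =>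
    intro a b ha hb
    have h := ih (a / 2) (b / 2) (by omega) (by omega)
    -- Splits off the lowest bit; the remaining bits are those of `a / 2` and `b / 2`.
    rw [sum_range_succ']
    simp only [Nat.div_div_eq_div_mul, ← pow_succ'] at h
    rw [h]
    simp only [zero_add, pow_one, pow_zero, Nat.div_one]
    split_ifs <;> first | omega | norm_num

theorem hasPSDDecomposition_rankingMatrix {n k : ℕ} (hk : n ≤ 2 ^ k) (σ : Equiv.Perm (Fin n)) :
    HasPSDDecomposition ((4 * k + 1) / 2) (2 * n * (4 * k + 1))
      (fromBlocks 0 (rankingMatrix σ) (rankingMatrix σ)ᵀ 0) := by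
  -- A coordinate `(l, x)` tests for the prefix `x` above bit `l`, together with bit `0` in `X` and
  -- bit `1` in `Y`. The products sum to `2 · [σ i < σ j]`, and `none` contributes the `-1`. Each
  -- level has at most one nonzero coordinate per row, so squared row norms are at most `4k + 1`.
  let X : Matrix (Fin n) (Option (Fin k × Fin n)) ℝ := fun i o => o.elim 1 fun x =>
    if (σ i : ℕ) / 2 ^ ((x.1 : ℕ) + 1) = x.2 ∧ (σ i : ℕ) / 2 ^ (x.1 : ℕ) % 2 = 0 then 2 else 0
  let Y : Matrix (Fin n) (Option (Fin k × Fin n)) ℝ := fun i o => o.elim (-1) fun x =>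
    if (σ i : ℕ) / 2 ^ ((x.1 : ℕ) + 1) = x.2 ∧ (σ i : ℕ) / 2 ^ (x.1 : ℕ) % 2 = 1 then 1 else 0
  have hlt : ∀ (i : Fin n) (l : ℕ), (σ i : ℕ) / 2 ^ l < n := fun i l =>
    (Nat.div_le_self _ _).trans_lt (σ i).2
  have hXY : X * Yᵀ = rankingMatrix σ := by
    ext i j
    rw [mul_apply, Fintype.sum_option, Fintype.sum_prod_type]
    simp only [transpose_apply]
    have h1 : ∀ l : Fin k, ∑ x : Fin n, X i (some (l, x)) * Y j (some (l, x)) =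
        2 * if (σ i : ℕ) / 2 ^ ((l : ℕ) + 1) = (σ j : ℕ) / 2 ^ ((l : ℕ) + 1) ∧
          (σ i : ℕ) / 2 ^ (l : ℕ) % 2 = 0 ∧ (σ j : ℕ) / 2 ^ (l : ℕ) % 2 = 1 then 1 else 0 := by
      intro l
      rw [sum_eq_single ⟨_, hlt i ((l : ℕ) + 1)⟩]
      · simp only [X, Y, Option.elim_some, true_and]
        split_ifs <;> first | omega | norm_num
      · intro x _ hx
        have : ¬ (σ i : ℕ) / 2 ^ ((l : ℕ) + 1) = x := fun h => hx (Fin.ext h.symm)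
        simp [X, this]
      · simp
    have h2 := sum_bit_lt k (σ i) (σ j) ((σ i).2.trans_le hk) ((σ j).2.trans_le hk)
    rw [← Fin.sum_univ_eq_sum_range (fun l => if (σ i : ℕ) / 2 ^ (l + 1) = (σ j : ℕ) / 2 ^ (l + 1) ∧
      (σ i : ℕ) / 2 ^ l % 2 = 0 ∧ (σ j : ℕ) / 2 ^ l % 2 = 1 then (1 : ℝ) else 0)] at h2
    rw [sum_congr rfl fun l _ => h1 l, ← mul_sum, h2]
    simp only [X, Y, Option.elim_none, rankingMatrix, Fin.lt_def]
    split_ifs <;> norm_num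
  have hnorm : ∀ Z : Matrix (Fin n) (Option (Fin k × Fin n)) ℝ, ∀ i, Z i none ^ 2 = 1 →
      (∀ l x, Z i (some (l, x)) ^ 2 ≤ if (σ i : ℕ) / 2 ^ ((l : ℕ) + 1) = x then 4 else 0) →
        ∑ o, Z i o ^ 2 ≤ 4 * k + 1 := by
    intro Z i h0 h1
    rw [Fintype.sum_option, Fintype.sum_prod_type, h0, add_comm]
    have h2 : ∀ l ∈ (univ : Finset (Fin k)), ∑ x : Fin n, Z i (some (l, x)) ^ 2 ≤ 4 := by
      intro l _
      refine (sum_le_sum fun x _ => h1 l x).trans ?_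
      rw [sum_eq_single ⟨_, hlt i ((l : ℕ) + 1)⟩]
      · simp
      · intro x _ hx
        exact if_neg fun h => hx (Fin.ext h.symm)
      · simp
    have := sum_le_sum h2
    rw [sum_const, card_univ, Fintype.card_fin, nsmul_eq_mul] at this
    linarith
  have hX : ∀ i, ∑ o, X i o ^ 2 ≤ 4 * k + 1 := fun i => hnorm X i (by simp [X]) fun l x => by
    simp only [X, Option.elim_some]
    split_ifs <;> first | omega | norm_num
  have hY : ∀ i, ∑ o, Y i o ^ 2 ≤ 4 * k + 1 := fun i => hnorm Y i (by simp [Y]) fun l x => by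
    simp only [Y, Option.elim_some]
    split_ifs <;> first | omega | norm_num
  have h := hasPSDDecomposition_fromBlocks X Y hX hY (τ := 2 * n * (4 * k + 1)) (by
    have h1 := sum_le_sum fun i (_ : i ∈ univ) => hX i
    have h2 := sum_le_sum fun i (_ : i ∈ univ) => hY i
    rw [sum_const, card_univ, Fintype.card_fin, nsmul_eq_mul] at h1 h2
    linarith)
  rwa [hXY] at h

theorem gambling_exists_algorithm (n : ℕ) {G : ℝ} (hG : 0 < G) :
    ∃ A : OMPAlgorithm (gamblingSpace n),
      A.AchievesRegret G fun T => 240 * (G * Real.log n * √(n * T)) := by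
  -- For `n ≤ 1` the claimed bound is `0`, as `log n = 0`; the space is then a single matrix.
  rcases lt_or_ge n 2 with hn | hn
  · have hsub : ∀ U ∈ gamblingSpace n, U = rankingMatrix 1 := by
      intro U hU
      have h1 : n = 0 ∨ n = 1 := by omega
      have h2 : Set.range (rankingMatrix (n := n)) ⊆ {rankingMatrix 1} := by
        rintro _ ⟨σ, rfl⟩
        rcases h1 with rfl | rfl <;> exact congrArg _ (Subsingleton.elim _ _)
      exact convexHull_min h2 (convex_singleton _) hU
    have hmem : rankingMatrix 1 ∈ gamblingSpace n := subset_convexHull ℝ _ ⟨_, rfl⟩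
    refine ⟨⟨fun _ _ => rankingMatrix 1, fun _ _ => hmem⟩, fun p l _ T => ?_⟩
    have hne : Nonempty (gamblingSpace n) := ⟨⟨_, hmem⟩⟩
    have h0 : 0 ≤ 240 * (G * Real.log n * √(n * T)) := by
      have := Real.log_natCast_nonneg n
      positivity
    refine le_trans (sub_nonpos.2 (le_ciInf ?_)) h0
    rintro ⟨U, hU⟩
    obtain rfl := hsub U hU
    exact le_rfl
  · have hn2 : (2 : ℝ) ≤ n := by exact_mod_cast hn
    obtain ⟨k, hk⟩ : ∃ k, k = Nat.log 2 n + 1 := ⟨_, rfl⟩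
    have hkn : n ≤ 2 ^ k := by
      rw [hk]; exact (Nat.lt_pow_succ_log_self one_lt_two n).le
    have hdec : ∀ W ∈ gamblingSpace n,
        HasPSDDecomposition ((4 * k + 1) / 2) (2 * n * (4 * k + 1)) (fromBlocks 0 W Wᵀ 0) := by
      refine convexHull_min (t := {W | HasPSDDecomposition _ _ (fromBlocks 0 W Wᵀ 0)}) ?_ ?_
      · rintro _ ⟨σ, rfl⟩
        exact hasPSDDecomposition_rankingMatrix hkn σ
      · intro W hW W' hW' a b ha hb hab
        have := convex_hasPSDDecomposition _ _ hW hW' ha hb hab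
        simpa [fromBlocks_smul, fromBlocks_add] using this
    obtain ⟨A, hA⟩ := exists_algorithm_of_psd (𝒲 := gamblingSpace n) hG (by positivity) (by positivity)
      (convex_convexHull ℝ _) (gamblingSpace_nonempty n) gamblingSpace_box Sum.inl Sum.inr
      fun W hW => ⟨_, fun i j => rfl, hdec W hW⟩
    refine ⟨A, fun p l hl T => (hA p l hl T).trans ?_⟩
    have hklog : (4 * k + 1 : ℝ) ≤ 15 * Real.log n := by
      have h1 : (2 : ℝ) ^ Nat.log 2 n ≤ n := by
        exact_mod_cast Nat.pow_log_le_self 2 (by omega)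
      have h2 := Real.log_le_log (by positivity) h1
      rw [Real.log_pow] at h2
      have h3 := Real.log_le_log (by norm_num) hn2
      have h4 := Real.log_two_gt_d9
      have h5 : (0 : ℝ) ≤ Nat.log 2 n := by positivity
      rw [hk]
      push_cast
      nlinarith
    have hsq : ((4 * k + 1) / 2 * (2 * n * (4 * k + 1)) * T : ℝ) = (4 * k + 1) ^ 2 * (n * T) := by
      ring
    simp only
    rw [hsq, Real.sqrt_mul (by positivity), Real.sqrt_sq (by positivity)]
    have h6 := mul_le_mul_of_nonneg_right hklog (mul_nonneg hG.le (Real.sqrt_nonneg ((n : ℝ) * T)))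
    linarith

end Gambling

/-! ### Singular values and the trace norm. -/

section SingularValueDecomposition

variable {n m : ℕ}

/-- Right singular vectors `v`, left singular vectors `u` (zero where the singular value vanishes)
and singular values `σ` of a real matrix. -/
structure IsSVD (W : Matrix (Fin n) (Fin m) ℝ) (u : Fin m → Fin n → ℝ) (v : Fin m → Fin m → ℝ)
    (σ : Fin m → ℝ) : Prop where
  nonneg : ∀ k, 0 ≤ σ k
  traceNorm_eq : traceNorm W = ∑ k, σ k
  mul_left : ∀ k i, σ k * u k i = ∑ j, W i j * v k j
  mul_right : ∀ k j, σ k * v k j = ∑ i, W i j * u k i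
  norm_right : ∀ k, ∑ j, v k j ^ 2 = 1
  norm_left : ∀ k, ∑ i, u k i ^ 2 ≤ 1
  bessel_right : ∀ y : Fin m → ℝ, ∑ k, (∑ j, y j * v k j) ^ 2 ≤ ∑ j, y j ^ 2
  bessel_left : ∀ y : Fin n → ℝ, ∑ k, (∑ i, y i * u k i) ^ 2 ≤ ∑ i, y i ^ 2
  eq_sum : ∀ i j, W i j = ∑ k, σ k * (u k i * v k j)

theorem exists_isSVD (W : Matrix (Fin n) (Fin m) ℝ) : ∃ u v σ, IsSVD W u v σ := by
  set T := Matrix.toEuclideanLin W with hT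
  have hfr : Module.finrank ℝ (EuclideanSpace ℝ (Fin m)) = m := by simp
  let b := T.isSymmetric_adjoint_comp_self.eigenvectorBasis hfr
  let σ : Fin m → ℝ := fun k => T.singularValues k
  have hadj : ∀ k, T.adjoint (T (b k)) = σ k ^ 2 • b k := by
    intro k
    have := T.isSymmetric_adjoint_comp_self.apply_eigenvectorBasis hfr k
    rw [← T.sq_singularValues_fin hfr k] at this
    exact this
  have hTapp : ∀ x i, T x i = ∑ j, W i j * x j := fun x i => rfl
  have hAapp : ∀ x j, T.adjoint x j = ∑ i, W i j * x i := by
    intro x j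
    rw [hT, ← Matrix.toEuclideanLin_conjTranspose_eq_adjoint]
    rfl
  have hinner : ∀ k l, inner ℝ (T (b k)) (T (b l)) = if k = l then σ k ^ 2 else 0 := by
    intro k l
    rw [← LinearMap.adjoint_inner_left, hadj, real_inner_smul_left,
      orthonormal_iff_ite.1 b.orthonormal]
    simp
  have hzero : ∀ k, σ k = 0 → T (b k) = 0 := by
    intro k hk
    have := hinner k k
    rw [if_pos rfl, hk, zero_pow two_ne_zero] at this
    exact inner_self_eq_zero.1 this
  have hσ : ∀ k, 0 ≤ σ k := fun k => T.singularValues_nonneg k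
  -- Since `0⁻¹ = 0`, `u k` vanishes when `σ k` does; the others are orthonormal, which is enough
  -- for Bessel's inequality.
  let u : Fin m → EuclideanSpace ℝ (Fin n) := fun k => (σ k)⁻¹ • T (b k)
  have hσu : ∀ k, σ k • u k = T (b k) := by
    intro k
    by_cases hk : σ k = 0
    · rw [hzero k hk, hk, zero_smul]
    · simp only [u, smul_smul, mul_inv_cancel₀ hk, one_smul]
  have hort : Orthonormal ℝ fun k : {k // σ k ≠ 0} => u k := by
    rw [orthonormal_iff_ite]
    rintro ⟨k, hk⟩ ⟨l, hl⟩
    simp only [u, real_inner_smul_left, real_inner_smul_right, hinner, Subtype.mk.injEq]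
    split_ifs with h
    · subst h; field_simp
    · simp
  have hbesl : ∀ y : EuclideanSpace ℝ (Fin n), ∑ k, (inner ℝ (u k) y) ^ 2 ≤ ‖y‖ ^ 2 := by
    intro y
    have h1 := hort.sum_inner_products_le y (s := univ)
    simp only [Real.norm_eq_abs, sq_abs] at h1
    refine le_trans (le_of_eq ?_) h1
    rw [← sum_subtype_eq_sum_filter (s := univ) (p := fun k => σ k ≠ 0)
      (f := fun k => inner ℝ (u k) y ^ 2) |>.trans (sum_filter_of_ne ?_)]
    · simp
    · intro k _ hk h0
      exact hk (by simp [u, h0])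
  have hbesr : ∀ y : EuclideanSpace ℝ (Fin m), ∑ k, (inner ℝ (b k) y) ^ 2 ≤ ‖y‖ ^ 2 := by
    intro y
    have h1 := b.orthonormal.sum_inner_products_le y (s := univ)
    simpa only [Real.norm_eq_abs, sq_abs] using h1
  refine ⟨fun k i => u k i, fun k j => b k j, σ, hσ, ?_, ?_, ?_, ?_, ?_, ?_, ?_, ?_⟩
  · rw [traceNorm, Finsupp.sum, ← hT,
      Fin.sum_univ_eq_sum_range (fun k => T.singularValues k) m]
    refine sum_subset (fun k hk => ?_) fun k _ hk => Finsupp.notMem_support_iff.1 hk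
    rw [mem_range]
    by_contra! h
    exact Finsupp.mem_support_iff.1 hk (T.singularValues_of_finrank_le (hfr.trans_le h))
  · intro k i
    rw [← hTapp, ← hσu]
    rfl
  · intro k j
    rw [← hAapp]
    by_cases hk : σ k = 0
    · simp [u, hk]
    · simp only [u, map_smul, hadj, smul_smul]
      rw [sq, inv_mul_cancel_left₀ hk]
      rfl
  · intro k
    have := b.orthonormal.1 k
    rw [EuclideanSpace.norm_eq, Real.sqrt_eq_one] at this
    simpa using this
  · intro k
    have h1 : ‖u k‖ ^ 2 ≤ 1 := by
      by_cases hk : σ k = 0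
      · simp [u, hk]
      · have := hort.1 ⟨k, hk⟩
        simp only at this
        rw [this, one_pow]
    rw [EuclideanSpace.norm_sq_eq] at h1
    simpa using h1
  · intro y
    have h1 := hbesr (WithLp.toLp 2 y)
    rw [EuclideanSpace.norm_sq_eq] at h1
    simpa [PiLp.inner_apply] using h1
  · intro y
    have h1 := hbesl (WithLp.toLp 2 y)
    rw [EuclideanSpace.norm_sq_eq] at h1
    simpa [PiLp.inner_apply] using h1
  · intro i j
    have h1 : T (EuclideanSpace.single j 1) i = W i j := by
      rw [hTapp]
      simp
    rw [← h1, ← b.sum_repr' (EuclideanSpace.single j 1), map_sum]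
    have h2 : ∀ k, inner ℝ (b k) (EuclideanSpace.single j (1 : ℝ)) = b k j := by
      intro k
      simp [PiLp.inner_apply]
    simp only [h2, map_smul, ← hσu]
    simp only [WithLp.ofLp_sum, WithLp.ofLp_smul, Finset.sum_apply, Pi.smul_apply, smul_eq_mul]
    exact sum_congr rfl fun k _ => by ring

theorem sum_mul_le_one {κ : Type} [Fintype κ] {a b : κ → ℝ} (ha : ∑ k, a k ^ 2 ≤ 1)
    (hb : ∑ k, b k ^ 2 ≤ 1) : ∑ k, a k * b k ≤ 1 := by
  have h := sum_mul_sq_le_sq_mul_sq univ a b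
  have h1 : (∑ k, a k ^ 2) * ∑ k, b k ^ 2 ≤ 1 :=
    mul_le_one₀ ha (sum_nonneg fun k _ => sq_nonneg _) hb
  exact (abs_le_one_iff_mul_self_le_one.2 (by rw [← sq]; exact h.trans h1) |> abs_le.1).2

namespace IsSVD

variable {W W' : Matrix (Fin n) (Fin m) ℝ} {u u' : Fin m → Fin n → ℝ} {v v' : Fin m → Fin m → ℝ}
  {σ σ' : Fin m → ℝ}

theorem sq_left_le (h : IsSVD W u v σ) (i : Fin n) : ∑ k, u k i ^ 2 ≤ 1 := by
  simpa [Pi.single_apply] using h.bessel_left (Pi.single i 1)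

theorem sq_right_le (h : IsSVD W u v σ) (j : Fin m) : ∑ k, v k j ^ 2 ≤ 1 := by
  simpa [Pi.single_apply] using h.bessel_right (Pi.single j 1)

/-- Together with `pairing_le`, this exhibits the trace norm as a maximum of linear functionals. -/
theorem traceNorm_eq_pairing (h : IsSVD W u v σ) :
    traceNorm W = ∑ k, ∑ j, (∑ i, W i j * u k i) * v k j := by
  rw [h.traceNorm_eq]
  refine sum_congr rfl fun k _ => ?_
  simp only [← h.mul_right, mul_assoc, ← sq]
  rw [← mul_sum, h.norm_right, mul_one]

/-- The pairing with partial isometries is bounded by the trace norm. -/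
theorem pairing_le (h : IsSVD W u v σ) (h' : IsSVD W' u' v' σ') :
    ∑ k, ∑ j, (∑ i, W i j * u' k i) * v' k j ≤ traceNorm W := by
  have h1 : ∀ k, ∑ j, (∑ i, W i j * u' k i) * v' k j =
      ∑ l, σ l * ((∑ i, u l i * u' k i) * ∑ j, v l j * v' k j) := by
    intro k
    simp only [h.eq_sum, sum_mul, mul_sum]
    rw [sum_congr rfl fun j _ => sum_comm, sum_comm]
    refine sum_congr rfl fun l _ => ?_
    rw [sum_comm]
    rw [sum_comm]
    refine sum_congr rfl fun j _ => sum_congr rfl fun i _ => by ring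
  rw [sum_congr rfl fun k _ => h1 k, sum_comm, h.traceNorm_eq]
  refine sum_le_sum fun l _ => ?_
  rw [← mul_sum]
  refine mul_le_of_le_one_right (h.nonneg l) (sum_mul_le_one ?_ ?_)
  · exact (h'.bessel_left (u l)).trans (h.norm_left l)
  · exact (h'.bessel_right (v l)).trans (h.norm_right l).le

end IsSVD

/-- Pairing with the singular vectors of the combination is linear in the matrix, and on each
summand is at most its trace norm. -/
theorem traceNorm_convex_le (W W' : Matrix (Fin n) (Fin m) ℝ) {a b : ℝ} (ha : 0 ≤ a)
    (hb : 0 ≤ b) : traceNorm (a • W + b • W') ≤ a * traceNorm W + b * traceNorm W' := by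
  obtain ⟨u, v, σ, h⟩ := exists_isSVD W
  obtain ⟨u', v', σ', h'⟩ := exists_isSVD W'
  obtain ⟨u₀, v₀, σ₀, h₀⟩ := exists_isSVD (a • W + b • W')
  rw [h₀.traceNorm_eq_pairing]
  have h1 := mul_le_mul_of_nonneg_left (h.pairing_le h₀) ha
  have h2 := mul_le_mul_of_nonneg_left (h'.pairing_le h₀) hb
  refine le_trans (le_of_eq ?_) (add_le_add h1 h2)
  simp only [Matrix.add_apply, Matrix.smul_apply, smul_eq_mul, mul_sum, sum_mul,
    ← sum_add_distrib]
  refine sum_congr rfl fun k _ => sum_congr rfl fun j _ => sum_congr rfl fun i _ => by ring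

/-- The trace norm is at most the sum of the norms of the columns. -/
theorem traceNorm_le_sum_column (W : Matrix (Fin n) (Fin m) ℝ) :
    traceNorm W ≤ ∑ j, √(∑ i, W i j ^ 2) := by
  obtain ⟨u, v, σ, h⟩ := exists_isSVD W
  rw [h.traceNorm_eq_pairing, sum_comm]
  refine sum_le_sum fun j _ => Real.le_sqrt_of_sq_le ?_
  refine (sum_mul_sq_le_sq_mul_sq _ _ _).trans ?_
  exact (mul_le_of_le_one_right (sum_nonneg fun _ _ => sq_nonneg _) (h.sq_right_le j)).trans
    (h.bessel_left fun i => W i j)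

/-- Split each singular value evenly: `X = U √Σ`, `Y = V √Σ`. By Cauchy-Schwarz a squared row norm
`∑ σ u²` of `X` is at most `‖σu‖ ‖u‖`, hence at most the norm of a row of `W`, which is at most `√m
≤ √n`. Rows of `Y` are compared with columns of `W` in the same way. -/
theorem hasPSDDecomposition_of_traceNorm_le {W : Matrix (Fin n) (Fin m) ℝ} {τ : ℝ} (hmn : m ≤ n)
    (hbox : ∀ i j, W i j ∈ Set.Icc (-1 : ℝ) 1) (hτ : traceNorm W ≤ τ) :
    HasPSDDecomposition (√n / 2) (2 * τ) (fromBlocks 0 W Wᵀ 0) := by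
  obtain ⟨u, v, σ, h⟩ := exists_isSVD W
  let X : Matrix (Fin n) (Fin m) ℝ := fun i k => √(σ k) * u k i
  let Y : Matrix (Fin m) (Fin m) ℝ := fun j k => √(σ k) * v k j
  have hXsq : ∀ i k, X i k ^ 2 = σ k * u k i * u k i := fun i k => by
    simp only [X, mul_pow, Real.sq_sqrt (h.nonneg k)]; ring
  have hYsq : ∀ j k, Y j k ^ 2 = σ k * v k j * v k j := fun j k => by
    simp only [Y, mul_pow, Real.sq_sqrt (h.nonneg k)]; ring
  have hsq : ∀ i j, W i j ^ 2 ≤ 1 := fun i j =>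
    (sq_le_one_iff_abs_le_one _).2 (abs_le.2 (hbox i j))
  have hX : ∀ i, ∑ k, X i k ^ 2 ≤ √n := by
    intro i
    simp only [hXsq]
    refine Real.le_sqrt_of_sq_le ((sum_mul_sq_le_sq_mul_sq _ _ _).trans ?_)
    refine (mul_le_of_le_one_right (sum_nonneg fun _ _ => sq_nonneg _) (h.sq_left_le i)).trans ?_
    simp only [h.mul_left]
    refine (h.bessel_right (W i)).trans ((sum_le_sum fun j _ => hsq i j).trans ?_)
    simpa using hmn
  have hY : ∀ j, ∑ k, Y j k ^ 2 ≤ √n := by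
    intro j
    simp only [hYsq]
    refine Real.le_sqrt_of_sq_le ((sum_mul_sq_le_sq_mul_sq _ _ _).trans ?_)
    refine (mul_le_of_le_one_right (sum_nonneg fun _ _ => sq_nonneg _) (h.sq_right_le j)).trans ?_
    simp only [h.mul_right]
    refine (h.bessel_left fun i => W i j).trans ((sum_le_sum fun i _ => hsq i j).trans ?_)
    simp
  have htr : ∑ i, ∑ k, X i k ^ 2 + ∑ j, ∑ k, Y j k ^ 2 ≤ 2 * τ := by
    simp only [hXsq, hYsq, mul_assoc, ← sq]
    rw [sum_comm (s := (univ : Finset (Fin n))), sum_comm (f := fun j k => σ k * v k j ^ 2)]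
    simp only [← mul_sum, h.norm_right, mul_one]
    have h1 : ∑ k, σ k * ∑ i, u k i ^ 2 ≤ ∑ k, σ k :=
      sum_le_sum fun k _ => mul_le_of_le_one_right (h.nonneg k) (h.norm_left k)
    rw [← h.traceNorm_eq] at h1 ⊢
    linarith
  have hXY : X * Yᵀ = W := by
    ext i j
    rw [mul_apply, h.eq_sum i j]
    refine sum_congr rfl fun k _ => ?_
    change √(σ k) * u k i * (√(σ k) * v k j) = _
    rw [mul_mul_mul_comm, Real.mul_self_sqrt (h.nonneg k)]
  have := hasPSDDecomposition_fromBlocks X Y hX hY htr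
  rwa [hXY] at this

end SingularValueDecomposition

/-! ### Online collaborative filtering. -/

section Filtering

theorem filteringSpace_convex (n m : ℕ) (τ : ℝ) : Convex ℝ (filteringSpace n m τ) := by
  rintro W ⟨hW, ht⟩ W' ⟨hW', ht'⟩ a b ha hb hab
  refine ⟨convex_box n m hW hW' ha hb hab, (traceNorm_convex_le W W' ha hb).trans ?_⟩
  exact (convex_Iic τ) ht ht' ha hb hab

theorem filteringSpace_nonempty (n m : ℕ) {τ : ℝ} (hτ : 0 ≤ τ) :
    (filteringSpace n m τ).Nonempty :=
  ⟨0, fun i j => by simp, by simpa [traceNorm] using hτ⟩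

theorem filtering_exists_algorithm {n m : ℕ} {G τ : ℝ} (hG : 0 < G) (hτ : 0 < τ) (hmn : m ≤ n) :
    ∃ A : OMPAlgorithm (filteringSpace n m τ),
      A.AchievesRegret G fun T => 16 * (G * √(τ * T * √n)) := by
  rcases Nat.eq_zero_or_pos n with rfl | hn
  · exact exists_algorithm_of_isEmpty (filteringSpace_nonempty 0 m hτ.le) _ _
  · obtain ⟨A, hA⟩ := exists_algorithm_of_psd (𝒲 := filteringSpace n m τ) (β := √n / 2)
      (τ := 2 * τ) hG (by positivity) (by positivity) (filteringSpace_convex n m τ)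
      (filteringSpace_nonempty n m hτ.le) (fun W hW => hW.1) Sum.inl Sum.inr fun W hW =>
        ⟨_, fun i j => rfl, hasPSDDecomposition_of_traceNorm_le hmn hW.1 hW.2⟩
    refine ⟨A, fun p l hl T => (hA p l hl T).trans_eq ?_⟩
    simp only
    rw [show √(n : ℝ) / 2 * (2 * τ) * T = τ * T * √n by ring]

theorem filtering_forcedRegret {n m T : ℕ} {G τ : ℝ} (hG : 0 < G) (hm : 1 ≤ m) (hmn : m ≤ n)
    (hτ : √n ≤ τ) (hτm : τ ≤ m * √n) (hT : τ * √n ≤ T) :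
    OMPForcedRegret (filteringSpace n m τ) G T (1 / 12 * (G * √(τ * T * √n))) := by
  have hn : (1 : ℝ) ≤ n := by exact_mod_cast hm.trans hmn
  have hsn : 0 < √(n : ℝ) := Real.sqrt_pos.2 (by linarith)
  have hsq : √(n : ℝ) * √n = n := Real.mul_self_sqrt (by linarith)
  have hτ0 : 0 < τ := hsn.trans_le hτ
  -- A column of signs has norm `√n`, so `q` full columns fit into the trace budget `τ`. They
  -- shatter `q n` entries, and `τ √n ≤ 2 q n`.
  obtain ⟨q, hq⟩ : ∃ q, q = ⌊τ / √n⌋₊ := ⟨_, rfl⟩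
  have hq1 : 1 ≤ q := by
    rw [hq, Nat.one_le_floor_iff, one_le_div hsn]; exact hτ
  have hqτ : q * √n ≤ τ := by
    rw [← le_div_iff₀ hsn, hq]; exact Nat.floor_le (by positivity)
  have hτq : τ < (q + 1) * √n := by
    rw [← div_lt_iff₀ hsn, hq]; exact Nat.lt_floor_add_one _
  have hqm : q ≤ m := by
    rw [hq]
    refine Nat.floor_le_of_le ?_
    rwa [div_le_iff₀ hsn]
  have hqnT : q * n ≤ T := by
    have : (q * n : ℝ) ≤ T := by
      rw [← hsq, ← mul_assoc]
      exact (mul_le_mul_of_nonneg_right hqτ hsn.le).trans hT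
    exact_mod_cast this
  refine (forcedRegret_of_shattered (k := q * n) (T := T) (fun W hW => hW.1)
    (Nat.mul_pos hq1 (hm.trans hmn)) hqnT hG
    (fun x => ((finProdFinEquiv.symm x).2, Fin.castLE hqm (finProdFinEquiv.symm x).1))
    fun s hs => ?_).mono (forcedRegret_const_le hG ?_)
  · let U : Matrix (Fin n) (Fin m) ℝ := fun i j =>
      if h : (j : ℕ) < q then s (finProdFinEquiv (⟨j, h⟩, i)) else 0
    have hUsq : ∀ i j, U i j ^ 2 = if (j : ℕ) < q then 1 else 0 := by
      intro i j
      simp only [U]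
      split_ifs with h
      · rcases hs (finProdFinEquiv (⟨j, h⟩, i)) with h | h <;> simp [h]
      · simp
    refine ⟨U, ⟨fun i j => ?_, ?_⟩, fun x => ?_⟩
    · rw [Set.mem_Icc, ← abs_le, ← sq_le_one_iff_abs_le_one, hUsq]
      split_ifs <;> norm_num
    · refine (traceNorm_le_sum_column U).trans (le_trans (le_of_eq ?_) hqτ)
      simp only [hUsq]
      have h1 : ∀ j : Fin m, √(∑ _i : Fin n, if (j : ℕ) < q then (1 : ℝ) else 0) =
          if (j : ℕ) < q then √n else 0 := by
        intro j
        split_ifs <;> simp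
      rw [sum_congr rfl fun j _ => h1 j, ← sum_filter, sum_const, nsmul_eq_mul,
        Fin.card_filter_val_lt, min_eq_right hqm]
    · have h1 : (Fin.castLE hqm (finProdFinEquiv.symm x).1 : ℕ) < q :=
        (finProdFinEquiv.symm x).1.2
      simp only [U, dif_pos h1]
      congr 1
      exact finProdFinEquiv.apply_symm_apply x
  · have h1 : τ * √n ≤ 4 * (q * n) := by
      have h2 : (1 : ℝ) ≤ q := by exact_mod_cast hq1
      have h3 : τ * √n ≤ (q + 1) * √n * √n := mul_le_mul_of_nonneg_right hτq.le hsn.le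
      rw [mul_assoc, hsq] at h3
      nlinarith
    have h2 := mul_le_mul_of_nonneg_right h1 (Nat.cast_nonneg (α := ℝ) T)
    push_cast
    linarith

end Filtering

end

theorem OMPAlgorithm.AchievesRegret.mono_bound {m n : ℕ} {𝒲 : Set (Matrix (Fin m) (Fin n) ℝ)}
    {A : OMPAlgorithm 𝒲} {G : ℝ} {B B' : ℕ → ℝ} (h : A.AchievesRegret G B)
    (hB : ∀ T, B T ≤ B' T) : A.AchievesRegret G B' :=
  fun p l hl T => (h p l hl T).trans (hB T)

theorem corollary5p1 :
    ∃ C c : ℝ, 0 < C ∧ 0 < c ∧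
      -- the regret bound, with a constant independent of everything, in particular of `m` and `n`
      (∀ (m n : ℕ) (𝒲 : Set (Matrix (Fin m) (Fin n) ℝ)) (G β τ : ℝ),
        0 < G → 0 < β → 0 < τ → Convex ℝ 𝒲 → 𝒲.Nonempty →
        (∀ W ∈ 𝒲, ∀ i j, W i j ∈ Set.Icc (-1 : ℝ) 1) → IsDecomposable β τ 𝒲 →
        ∃ A : OMPAlgorithm 𝒲, A.AchievesRegret G fun T => C * (G * √(β * τ * T))) ∧
      -- online max-cut, with the matching lower bound
      (∀ (n : ℕ) (G : ℝ), 0 < G →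
        ∃ A : OMPAlgorithm (maxCutSpace n), A.AchievesRegret G fun T => C * (G * √(n * T))) ∧
      (∀ (n T : ℕ) (G : ℝ), 0 < G → 2 ≤ n → n ≤ T →
        OMPForcedRegret (maxCutSpace n) G T (c * (G * √(n * T)))) ∧
      -- online gambling, with a lower bound that matches up to the factor `log n`
      (∀ (n : ℕ) (G : ℝ), 0 < G →
        ∃ A : OMPAlgorithm (gamblingSpace n),
          A.AchievesRegret G fun T => C * (G * Real.log n * √(n * T))) ∧
      (∀ (n T : ℕ) (G : ℝ), 0 < G → 2 ≤ n → n ≤ T →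
        OMPForcedRegret (gamblingSpace n) G T (c * (G * √(n * T)))) ∧
      -- online collaborative filtering, with the matching lower bound
      (∀ (n m : ℕ) (G τ : ℝ), 0 < G → 0 < τ → m ≤ n →
        ∃ A : OMPAlgorithm (filteringSpace n m τ),
          A.AchievesRegret G fun T => C * (G * √(τ * T * √n))) ∧
      (∀ (n m T : ℕ) (G τ : ℝ), 0 < G → 1 ≤ m → m ≤ n → √n ≤ τ → τ ≤ m * √n → τ * √n ≤ T →
        OMPForcedRegret (filteringSpace n m τ) G T (c * (G * √(τ * T * √n)))) := by
  -- `240 = 16 · 15` is dictated by gambling, where `4k + 1 ≤ 15 log n`; the other upper bounds hold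
  -- with `16`.
  refine ⟨240, 1 / 12, by norm_num, by norm_num, ?_, ?_, ?_, ?_, ?_, ?_, ?_⟩
  · intro m n 𝒲 G β τ hG hβ hτ hconv hne hbox hdec
    obtain ⟨A, hA⟩ := hdec.exists_algorithm hG hβ hτ hconv hne hbox
    exact ⟨A, hA.mono_bound fun T => by gcongr; norm_num⟩
  · intro n G hG
    obtain ⟨A, hA⟩ := maxCut_exists_algorithm n hG
    exact ⟨A, hA.mono_bound fun T => by gcongr; norm_num⟩
  · exact fun n T G hG hn hT => maxCut_forcedRegret hG hn hT
  · exact fun n G hG => gambling_exists_algorithm n hG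
  · exact fun n T G hG hn hT => gambling_forcedRegret hG hn hT
  · intro n m G τ hG hτ hmn
    obtain ⟨A, hA⟩ := filtering_exists_algorithm hG hτ hmn
    exact ⟨A, hA.mono_bound fun T => by gcongr; norm_num⟩
  · exact fun n m T G τ hG hm hmn h1 h2 h3 => filtering_forcedRegret hG hm hmn h1 h2 h3
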